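/- Let $(M,g)$ be a complete Riemannian manifold of dimension $n\ge 3$ with a chart at infinity, i.e. a diffeomorphism from the complement of a compact set $K\subset M$ onto the complement of a closed ball $B\subset\mathbb R^n$ centred at $0$, in which $$|g_{ij}-\delta_{ij}|=O(r^{-\tau}),\quad |\partial_k g_{ij}|=O(r^{-\tau-1}),\quad |\partial_k\partial_l g_{ij}|=O(r^{-\tau-2}),\qquad \tau>\tfrac{n-2}{2},$$ and suppose that the scalar curvature of $g$ is integrable. Then the mass $$m(g)=\lim_{r\to\infty}\int_{S_r}(\operatorname{div}_0 g-d\operatorname{tr}_0 g)(\nu)\,d\mathrm{vol}_{S_r}$$ exists; here $S_r=\{|x|=r\}$, $\nu$ is its outer unit normal, and the subscript $0$, like the surface measure, refers to the Euclidean metric of the chart. Let $H$ be the positive self-adjoint map with $g(HX,HY)=\langle X,Y\rangle_0$ on $\mathbb R^n\setminus B$, let $(e_i)$ be the standard basis of $\mathbb R^n$, and let $\omega$ be the connection form of the Levi-Civita connection $\nabla$ of $g$ in the $g$-orthonormal frame $(He_i)$, so that $\omega(X)\in\mathfrak{so}(n)$ is the endomorphism $e_j\mapsto\sum_k g(\nabla_X(He_j),He_k)\,e_k$.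 Let $(\mathbb V,\rho)$ be a finite-dimensional irreducible orthogonal (real) or unitary (complex) representation of $\mathfrak{so}(n)$; over $\mathbb R^n\setminus B$ the associated natural bundle is trivialized by the frame $(He_i)$, a constant section $\sigma\in\mathbb V$ satisfies $\nabla\sigma=\rho(\omega)\sigma=\sum_i e_i\otimes\rho(\omega(e_i))\sigma$. Let $\mathbb R^n\otimes\mathbb V=\bigoplus_{j=1}^N\mathbb W_j$ be an orthogonal decomposition into irreducible summands, with orthogonal projections $\Pi_j$. For $u,v\in\mathbb R^n$ let $u\wedge v\in\mathfrak{so}(n)$ be $X\mapsto\langle u,X\rangle v-\langle v,X\rangle u$. The conformal weight operator $B(\alpha\otimes v)=\sum_i e_i\otimes\rho(e_i\wedge\alpha)v$ of $\mathbb R^n\otimes\mathbb V$ acts on each $\mathbb W_j$ as multiplication by a real number $w(\lambda_j,\rho)$, the conformal weight of $\mathbb W_j$. Let $\mathbf a=(a_j)$ be real coefficients (for instance those of a Weitzenböck formula, i.e. such that $\sum_j a_j(\Pi_j\nabla)^*(\Pi_j\nabla)$ is an operator of order zero), let $A=\sum_j a_j\Pi_j$, and put $$\mu(\mathbf a)=-\sum_{j=1}^N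 a_j\,\frac{(\dim\mathbb W_j)\,w(\lambda_j,\rho)}{2n(n-1)} .$$ Then, for every orthonormal basis $(\sigma_\kappa)$ of $\mathbb V$, $$\lim_{r\to\infty}\Bigl(-\sum_\kappa\int_{S_r}\langle\nu\otimes\sigma_\kappa,A(\rho(\omega)\sigma_\kappa)\rangle_0\,d\mathrm{vol}_{S_r}\Bigr)=\mu(\mathbf a)\,m(g),$$ the limit on the left existing. In particular, if the limit of each single term exists, then $$-\sum_\kappa\lim_{r\to\infty}\int_{S_r}\langle\nu\otimes\sigma_\kappa,A(\rho(\omega)\sigma_\kappa)\rangle_0\,d\mathrm{vol}_{S_r}=\mu(\mathbf a)\,m(g).$$ (Dimensions are over the ground field of $\mathbb V$.) -/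

import Mathlib

open Filter Topology MeasureTheory Bundle Manifold Metric
open scoped ContDiff Matrix

attribute [local instance] LieRing.ofAssociativeRing

namespace UniversalMass

noncomputable section

/-- Euclidean space `ℝⁿ`. -/
abbrev Eucl (n : ℕ) : Type := EuclideanSpace ℝ (Fin n)

/-- The standard basis vector `e_i` of `ℝⁿ`. -/
def stdVec {n : ℕ} (i : Fin n) : Eucl n := EuclideanSpace.single i 1

/-- The partial derivative `∂_i f`. -/
def pd {n : ℕ} (i : Fin n) (f : Eucl n → ℝ) (x : Eucl n) : ℝ := fderiv ℝ f x (stdVec i)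

/-! ### Riemannian geometry of a metric given by its coefficients `G x = (g_ij(x))` -/

section Coordinates

variable {n : ℕ} (G : Eucl n → Matrix (Fin n) (Fin n) ℝ)

/-- The Christoffel symbols `Γ^k_{ij} = ½ g^{kl} (∂_i g_{jl} + ∂_j g_{il} - ∂_l g_{ij})` of the
Levi-Civita connection. -/
def christoffel (x : Eucl n) (k i j : Fin n) : ℝ :=
  (1 / 2) * ∑ l, (G x)⁻¹ k l *
    (pd i (fun y => G y j l) x + pd j (fun y => G y i l) x - pd l (fun y => G y i j) x)

/-- The Ricci curvature
`R_{ij} = ∂_k Γ^k_{ij} - ∂_j Γ^k_{ik} + Γ^k_{kl} Γ^l_{ij} - Γ^k_{jl} Γ^l_{ik}`. -/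
def ricci (x : Eucl n) (i j : Fin n) : ℝ :=
  ∑ k, (pd k (fun y => christoffel G y k i j) x - pd j (fun y => christoffel G y k i k) x) +
    ∑ k, ∑ l, (christoffel G x k k l * christoffel G x l i j -
      christoffel G x k j l * christoffel G x l i k)

/-- The scalar curvature `g^{ij} R_{ij}`. -/
def scal (x : Eucl n) : ℝ := ∑ i, ∑ j, (G x)⁻¹ i j * ricci G x i j

open scoped MatrixOrder in
/-- The positive self-adjoint map `H` with `g(HX, HY) = ⟨X, Y⟩₀`, that is `H = g^{-1/2}`. -/
def frameMap (x : Eucl n) : Matrix (Fin n) (Fin n) ℝ := CFC.sqrt (G x)⁻¹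

/-- The `l`-th coordinate of `∇_{∂_i} (H e_j)`, `∇` being the Levi-Civita connection. -/
def nablaFrame (x : Eucl n) (i j l : Fin n) : ℝ :=
  pd i (fun y => frameMap G y l j) x + ∑ m, christoffel G x l i m * frameMap G x m j

/-- The coefficients `ω_j^k(∂_i) = g(∇_{∂_i} (H e_j), H e_k)` of the connection form of the
Levi-Civita connection in the `g`-orthonormal frame `(H e_1, …, H e_n)`. -/
def connCoeff (x : Eucl n) (i j k : Fin n) : ℝ :=
  ∑ l, ∑ p, G x l p * nablaFrame G x i j l * frameMap G x p k

/-- `(div₀ g - d tr₀ g)_k = ∑_i (∂_i g_{ik} - ∂_k g_{ii})`. -/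
def massForm (x : Eucl n) (k : Fin n) : ℝ :=
  ∑ i, (pd i (fun y => G y i k) x - pd k (fun y => G y i i) x)

end Coordinates

/-- The integral `∫_{S_r} f(x, ν(x)) dvol_{S_r}` over the sphere of radius `r` centred at `0`, with
outer unit normal `ν`, for the Euclidean surface measure; here `x = r ν`. -/
def sphereIntegral {n : ℕ} {F : Type*} [NormedAddCommGroup F] [NormedSpace ℝ F]
    (f : Eucl n → Eucl n → F) (r : ℝ) : F :=
  r ^ (n - 1) • ∫ ν : sphere (0 : Eucl n) 1, f (r • (ν : Eucl n)) ν
    ∂((volume : Measure (Eucl n)).toSphere)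

/-- The flux `∫_{S_r} (div₀ g - d tr₀ g)(ν) dvol_{S_r}`. -/
def massIntegral {n : ℕ} (G : Eucl n → Matrix (Fin n) (Fin n) ℝ) (r : ℝ) : ℝ :=
  sphereIntegral (fun x ν => ∑ k, massForm G x k * ν k) r

/-- The mass `m(g) = lim_{r → ∞} ∫_{S_r} (div₀ g - d tr₀ g)(ν) dvol_{S_r}`. -/
def mass {n : ℕ} (G : Eucl n → Matrix (Fin n) (Fin n) ℝ) : ℝ :=
  limUnder atTop (massIntegral G)

/-! ### Asymptotically flat manifolds -/

/-- A chart at infinity: a diffeomorphism from the complement of a compact set onto the complement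
of a closed ball of `ℝⁿ`. -/
structure ChartAtInfinity (n : ℕ) (M : Type*) [TopologicalSpace M] [ChartedSpace (Eucl n) M] where
  /-- the compact set -/
  K : Set M
  isCompact_K : IsCompact K
  /-- the radius of the ball -/
  R : ℝ
  R_pos : 0 < R
  /-- the diffeomorphism -/
  Φ : OpenPartialHomeomorph M (Eucl n)
  source_eq : Φ.source = Kᶜ
  target_eq : Φ.target = (closedBall 0 R)ᶜ
  contMDiffOn : ContMDiffOn (𝓡 n) (𝓡 n) ∞ Φ Φ.source
  contMDiffOn_symm : ContMDiffOn (𝓡 n) (𝓡 n) ∞ Φ.symm Φ.target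

/-- The coefficients `g_ij` of the Riemannian metric of `M` in a chart at infinity. -/
def ChartAtInfinity.metric {n : ℕ} {M : Type*} [TopologicalSpace M] [ChartedSpace (Eucl n) M]
    [RiemannianBundle (fun p : M => TangentSpace (𝓡 n) p)]
    (c : ChartAtInfinity n M) (x : Eucl n) : Matrix (Fin n) (Fin n) ℝ :=
  Matrix.of fun i j =>
    inner ℝ (mfderiv (𝓡 n) (𝓡 n) c.Φ.symm x (stdVec i) : TangentSpace (𝓡 n) (c.Φ.symm x))
      (mfderiv (𝓡 n) (𝓡 n) c.Φ.symm x (stdVec j) : TangentSpace (𝓡 n) (c.Φ.symm x))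

/-- The metric of `M` is asymptotic of order `τ` to the Euclidean one in the chart `c`. -/
structure ChartAtInfinity.IsAsymptoticallyFlat {n : ℕ} {M : Type*} [TopologicalSpace M]
    [ChartedSpace (Eucl n) M] [RiemannianBundle (fun p : M => TangentSpace (𝓡 n) p)]
    (c : ChartAtInfinity n M) (τ : ℝ) : Prop where
  decay_zero : ∀ i j, (fun x => c.metric x i j - (1 : Matrix (Fin n) (Fin n) ℝ) i j)
    =O[Bornology.cobounded (Eucl n)] fun x => ‖x‖ ^ (-τ)
  decay_one : ∀ i j k, (fun x => pd k (fun y => c.metric y i j) x)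
    =O[Bornology.cobounded (Eucl n)] fun x => ‖x‖ ^ (-τ - 1)
  decay_two : ∀ i j k l, (fun x => pd k (pd l (fun y => c.metric y i j)) x)
    =O[Bornology.cobounded (Eucl n)] fun x => ‖x‖ ^ (-τ - 2)

/-- The scalar curvature is integrable, with respect to the Riemannian volume
`√(det g) dx`, over the end `M ∖ K` (over the compact set `K` it is always integrable). -/
def ChartAtInfinity.ScalIntegrable {n : ℕ} {M : Type*} [TopologicalSpace M]
    [ChartedSpace (Eucl n) M] [RiemannianBundle (fun p : M => TangentSpace (𝓡 n) p)]
    (c : ChartAtInfinity n M) : Prop :=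
  IntegrableOn (fun x => scal c.metric x * Real.sqrt (c.metric x).det) c.Φ.target

/-! ### Representations of `so(n)` -/

/-- The Lie algebra `so(n)` of skew-symmetric matrices. -/
abbrev SO (n : ℕ) : LieSubalgebra ℝ (Matrix (Fin n) (Fin n) ℝ) :=
  LieAlgebra.Orthogonal.so (Fin n) ℝ

/-- The element `u ∧ v : X ↦ ⟨u, X⟩ v - ⟨v, X⟩ u` of `so(n)`. -/
def wedge {n : ℕ} (u v : Eucl n) : SO n :=
  ⟨Matrix.of fun k j => u j * v k - v j * u k, by
    rw [LieAlgebra.Orthogonal.mem_so]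
    ext k j
    simp [Matrix.transpose_apply]
    ring⟩

/-- The value on `∂_i` of the `so(n)`-valued connection form: the skew endomorphism
`e_j ↦ ∑_k ω_j^k(∂_i) e_k`, written as `∑_{j < k} ω_j^k(∂_i) e_j ∧ e_k`. -/
def connForm {n : ℕ} (G : Eucl n → Matrix (Fin n) (Fin n) ℝ) (x : Eucl n) (i : Fin n) : SO n :=
  ∑ j, ∑ k, if j < k then connCoeff G x i j k • wedge (stdVec j) (stdVec k) else 0

/-- `W` is an irreducible invariant subspace for the family `φ` of operators. -/
structure IsIrreducibleSubspace {𝕜 L T : Type*} [Field 𝕜] [AddCommGroup T] [Module 𝕜 T]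
    (φ : L → T → T) (W : Submodule 𝕜 T) : Prop where
  invariant : ∀ X, ∀ t ∈ W, φ X t ∈ W
  ne_bot : W ≠ ⊥
  eq_bot_or_eq : ∀ U : Submodule 𝕜 T, U ≤ W → (∀ X, ∀ t ∈ U, φ X t ∈ U) → U = ⊥ ∨ U = W

/-- The space `ℝⁿ ⊗ V` with its product Hermitian structure: the tuple `(t_1, …, t_n)` stands for
`∑_i e_i ⊗ t_i`. -/
abbrev RnTensor (n : ℕ) (V : Type*) : Type _ := PiLp 2 (fun _ : Fin n => V)

section Representation

variable {n : ℕ} {𝕜 : Type*} [RCLike 𝕜] {V : Type*} [NormedAddCommGroup V] [InnerProductSpace 𝕜 V]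
  [Module ℝ V] [IsScalarTower ℝ 𝕜 V]

/-- The pure tensor `u ⊗ v`. -/
def pureTensor (𝕜 : Type*) [RCLike 𝕜] {V : Type*} [NormedAddCommGroup V] [InnerProductSpace 𝕜 V]
    (u : Eucl n) (v : V) : RnTensor n V :=
  WithLp.toLp 2 fun i => ((u i : ℝ) : 𝕜) • v

/-- An irreducible orthogonal (`𝕜 = ℝ`) or unitary (`𝕜 = ℂ`) representation. -/
structure IsIrreducibleOrthogonal (ρ : SO n →ₗ⁅ℝ⁆ Module.End 𝕜 V) : Prop where
  skew : ∀ X v w, inner 𝕜 (ρ X v) w = -inner 𝕜 v (ρ X w)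
  irreducible : IsIrreducibleSubspace (fun X v => ρ X v) (⊤ : Submodule 𝕜 V)

/-- The action `X (u ⊗ v) = X u ⊗ v + u ⊗ ρ(X) v` of `so(n)` on `ℝⁿ ⊗ V`. -/
def tensorAction (ρ : SO n →ₗ⁅ℝ⁆ Module.End 𝕜 V) (X : SO n) (t : RnTensor n V) : RnTensor n V :=
  WithLp.toLp 2 fun i =>
    ∑ j, (((X : Matrix (Fin n) (Fin n) ℝ) i j : ℝ) : 𝕜) • t j + ρ X (t i)

/-- An orthogonal decomposition `ℝⁿ ⊗ V = ⨁_j W_j` into irreducible summands. -/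
structure IsIrreducibleDecomposition (ρ : SO n →ₗ⁅ℝ⁆ Module.End 𝕜 V) {ι : Type*}
    (W : ι → Submodule 𝕜 (RnTensor n V)) : Prop where
  irreducible : ∀ j, IsIrreducibleSubspace (tensorAction ρ) (W j)
  orthogonal : Pairwise fun i j => W i ⟂ W j
  iSup_eq_top : ⨆ j, W j = ⊤

/-- The conformal weight operator `B(α ⊗ v) = ∑_i e_i ⊗ ρ(e_i ∧ α) v`. -/
def confWeightOp (ρ : SO n →ₗ⁅ℝ⁆ Module.End 𝕜 V) (t : RnTensor n V) : RnTensor n V :=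
  WithLp.toLp 2 fun i => ∑ j, ρ (wedge (stdVec i) (stdVec j)) (t j)

open Classical in
/-- The conformal weight of a summand `W` of `ℝⁿ ⊗ V`: the real number by which the conformal
weight operator acts on `W`. -/
def confWeight (ρ : SO n →ₗ⁅ℝ⁆ Module.End 𝕜 V) (W : Submodule 𝕜 (RnTensor n V)) : ℝ :=
  if h : ∃ w : ℝ, ∀ t ∈ W, confWeightOp ρ t = (w : 𝕜) • t then h.choose else 0

/-- The constant `μ(a) = -∑_j a_j (dim W_j) w(λ_j, ρ) / (2n(n-1))`. -/
def massConstant (ρ : SO n →ₗ⁅ℝ⁆ Module.End 𝕜 V) {ι : Type*} [Fintype ι]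
    (W : ι → Submodule 𝕜 (RnTensor n V)) (a : ι → ℝ) : ℝ :=
  -∑ j, a j * ((Module.finrank 𝕜 (W j) : ℝ) * confWeight ρ (W j) / (2 * n * ((n : ℝ) - 1)))

/-- The operator `A = ∑_j a_j Π_j`, where `Π_j` is the orthogonal projection onto `W_j`. -/
def weightedProj [FiniteDimensional 𝕜 V] {ι : Type*} [Fintype ι]
    (W : ι → Submodule 𝕜 (RnTensor n V)) (a : ι → ℝ) (t : RnTensor n V) : RnTensor n V :=
  ∑ j, ((a j : ℝ) : 𝕜) • (W j).starProjection t

/-- The derivative `∇σ = ρ(ω)σ = ∑_i e_i ⊗ ρ(ω(e_i))σ` of a constant section `σ`. -/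
def rhoConn (ρ : SO n →ₗ⁅ℝ⁆ Module.End 𝕜 V) (G : Eucl n → Matrix (Fin n) (Fin n) ℝ)
    (σ : V) (x : Eucl n) : RnTensor n V :=
  WithLp.toLp 2 fun i => ρ (connForm G x i) σ

/-- The boundary term `∫_{S_r} ⟨ν ⊗ σ, A(ρ(ω)σ)⟩₀ dvol_{S_r}`. -/
def boundaryIntegral [FiniteDimensional 𝕜 V] (ρ : SO n →ₗ⁅ℝ⁆ Module.End 𝕜 V) {ι : Type*}
    [Fintype ι] (W : ι → Submodule 𝕜 (RnTensor n V)) (a : ι → ℝ)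
    (G : Eucl n → Matrix (Fin n) (Fin n) ℝ) (σ : V) (r : ℝ) : 𝕜 :=
  sphereIntegral
    (fun x ν => inner 𝕜 (pureTensor 𝕜 ν σ) (weightedProj W a (rhoConn ρ G σ x))) r

end Representation

end

end UniversalMass

open UniversalMass

namespace UniversalMass

/-! Summed over an orthonormal basis of `V`, the boundary integrand becomes a trace: it is `∑ ν_a
ω_j^k(∂_i) t_{aijk}`, over `a`, `i` and `j < k`, with `t_{aijk} = tr_V(A_{ai} ρ(e_j ∧ e_k))` and
`A_{ai}` the blocks of `A` on `ℝⁿ ⊗ V`. The argument evaluates the two factors separately.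

Algebra. `A` commutes with `so(n)`, so `t` is an invariant tensor, skew in `j, k`. For `n ≥ 3` its
symmetrization in the second and fourth indices is a multiple `c` of one standard combination of
products of Kronecker deltas (`exists_symmetrization_eq`); symmetrizing removes what a totally skew
invariant, such as the volume form for `n = 4`, could contribute. The full contraction `∑ t_{ijji}`
equals `tr(AB) = ∑ a_j (dim W_j) w_j`, which gives `c = 2 μ(a)` (`traceTensor_symmetrization`). That
`B` is a scalar on each `W_j` follows from Schur's lemma for symmetric operators, since `B` is a
combination of Casimir operators and the identity.

Analysis. In the frame `H e_i`, with `H = g^{-1/2}`, one has `ω_j^k(∂_i) = ½(∂_j g_ik - ∂_k g_ij) +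
O(r^{-2τ-1})` (`connCoeff_sub_isBigO`). As `g` is symmetric, contracting the linear part with `t`
only sees the symmetrization just described, and the outcome is `-μ(a)` times the mass integrand
(`sum_skew_mul_eq`, `sum_boundary_integrand_eq`). The error, integrated over a sphere of area of
order `r^{n-1}`, tends to zero because `2τ > n - 2`.

The mass exists because the scalar curvature is the divergence of the mass form up to `O(r^{-2τ-2})`
(`scal_sub_isBigO`), which is integrable since `2τ + 2 > n`. The `r`-derivative of the flux through
`S_r` is the sphere integral of the divergence (`hasDerivAt_flux`), a fact derived here from the
rotation invariance of the sphere measure. -/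

theorem stdVec_apply {n : ℕ} (i j : Fin n) : stdVec i j = if j = i then 1 else 0 := by
  simp [stdVec]

/-! ### Smoothness of the metric coefficients -/

theorem ChartAtInfinity.contDiffOn_metric {n : ℕ} {M : Type*} [TopologicalSpace M]
    [ChartedSpace (Eucl n) M] [IsManifold (𝓡 n) ∞ M]
    [RiemannianBundle (fun p : M => TangentSpace (𝓡 n) p)]
    [IsContMDiffRiemannianBundle (𝓡 n) ∞ (Eucl n) (fun p : M => TangentSpace (𝓡 n) p)]
    (c : ChartAtInfinity n M) (i j : Fin n) :
    ContDiffOn ℝ ∞ (fun x => c.metric x i j) (closedBall 0 c.R)ᶜ := by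
  have hopen : IsOpen c.Φ.target := c.Φ.open_target
  have key : ∀ i : Fin n, ContMDiffOn (𝓡 n) ((𝓡 n).prod 𝓘(ℝ, Eucl n)) ∞
      (fun x : Eucl n => (⟨c.Φ.symm x, mfderiv (𝓡 n) (𝓡 n) c.Φ.symm x (stdVec i)⟩ :
        TotalSpace (Eucl n) (fun p : M => TangentSpace (𝓡 n) p))) c.Φ.target := by
    intro i
    have h1 := c.contMDiffOn_symm.contMDiffOn_tangentMapWithin (m := ∞) (n := ∞) (by simp)
      hopen.uniqueMDiffOn
    have h2 : ContMDiff (𝓡 n) (𝓡 n).tangent ∞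
        (fun x : Eucl n => (⟨x, stdVec i⟩ : TangentBundle (𝓡 n) (Eucl n))) := by
      rw [contMDiff_vectorSpace_iff_contDiff (V := fun _ => stdVec i)]
      exact contDiff_const
    -- The coordinate field is the tangent map of the inverse chart applied to a constant section of
    -- the tangent bundle of `ℝⁿ`.
    refine (h1.comp h2.contMDiffOn (fun x hx => hx)).congr fun x hx => ?_
    simp only [Function.comp_apply, tangentMapWithin, mfderivWithin_of_isOpen hopen hx]
  rw [← c.target_eq]
  rw [← contMDiffOn_iff_contDiffOn]
  exact ContMDiffOn.inner_bundle (key i) (key j)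

/-! ### Invariant 4-tensors -/

section InvariantTensors

/-- An infinitesimally rotation invariant `4`-tensor, skew in its last two arguments, is, after
symmetrization in its second and fourth arguments, a multiple of the standard one. -/
theorem exists_symmetrization_eq {n : ℕ} (hn : 3 ≤ n) {𝕜 : Type*} [Field 𝕜] [CharZero 𝕜]
    (t : Fin n → Fin n → Fin n → Fin n → 𝕜) (hskew : ∀ a i j k, t a i j k = -t a i k j)
    (hinv : ∀ p q, p ≠ q → ∀ a i j k,
      ((if a = p then t q i j k else 0) - if a = q then t p i j k else 0) +
      ((if i = p then t a q j k else 0) - if i = q then t a p j k else 0) +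
      ((if j = p then t a i q k else 0) - if j = q then t a i p k else 0) +
      ((if k = p then t a i j q else 0) - if k = q then t a i j p else 0) = 0) :
    ∃ c : 𝕜, ∀ a i j k, t a i j k + t a k j i =
      c * (2 * (if a = j then 1 else 0) * (if i = k then 1 else 0) -
        (if a = k then 1 else 0) * (if i = j then 1 else 0) -
        (if a = i then 1 else 0) * (if j = k then 1 else 0)) := by
  have hzero : ∀ a i j, t a i j j = 0 := fun a i j => by
    have := hskew a i j j
    have h2 : (2 : 𝕜) * t a i j j = 0 := by linear_combination this
    simpa using h2
  -- Dimension at least three enters here: a given pair of indices leaves room for another one to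
  -- rotate into.
  have third : ∀ p r : Fin n, ∃ q, q ≠ p ∧ q ≠ r := fun p r => by
    obtain ⟨q, hq⟩ := Finset.exists_mem_notMem_of_card_lt_card (s := {p, r})
      (t := Finset.univ) (by
        refine (Finset.card_le_two).trans_lt ?_
        simp; omega)
    exact ⟨q, by simpa [not_or] using hq⟩
  have h1 : ∀ p r, p ≠ r → t r r p r = 0 := fun p r hpr => by
    obtain ⟨q, hqp, hqr⟩ := third p r
    have := hinv p q hqp.symm r r q r
    grind
  -- The three components are unknowns. Rotations in the `(p, r)`-plane show that their total and
  -- two of their pairwise sums vanish, modulo `h1`; hence each of them is zero.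
  have ha : ∀ p q r, p ≠ q → p ≠ r → q ≠ r →
      t p r q r = 0 ∧ t r p q r = 0 ∧ t r r q p = 0 := fun p q r hpq hpr hqr => by
    have e1 := hinv p r hpr r r q r
    have e2 := hinv p r hpr p r q p
    have e3 := hinv p r hpr r p q p
    have e4 := h1 q p hpq.symm
    simp only [hpr, hqr, hpq.symm, hpr.symm, if_true, if_false] at e1 e2 e3
    exact ⟨by linear_combination -e1 - e3 - e4, by linear_combination -e1 - e2 - e4,
      by linear_combination e1 + e2 + e3 + 2 * e4⟩
  -- For four distinct indices the individual components need not vanish (volume form, `n = 4`);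
  -- rotating in the `(i, k)`-plane kills only the symmetrized sum.
  have hd : ∀ a i j k, a ≠ i → a ≠ k → i ≠ j → j ≠ k → i ≠ k →
      t a i j k + t a k j i = 0 := fun a i j k _ _ _ _ hik => by
    have := hinv i k hik a i j i
    grind
  have hb : ∀ a b i, a ≠ i → b ≠ i → t a i a i = t b i b i := fun a b i hai hbi => by
    by_cases hab : a = b
    · rw [hab]
    have := hinv a b hab a i b i
    grind
  have hb' : ∀ a b i, i ≠ a → i ≠ b → t i a i a = t i b i b := fun a b i hai hbi => by
    by_cases hab : a = b
    · rw [hab]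
    have := hinv a b hab i a i b
    grind
  have hc : ∃ c, ∀ a i, a ≠ i → t a i a i = c := by
    refine ⟨t ⟨0, by omega⟩ ⟨1, by omega⟩ ⟨0, by omega⟩ ⟨1, by omega⟩, fun a i hai => ?_⟩
    -- One index is changed at a time; passing through `q` keeps the two indices distinct at every
    -- stage.
    obtain ⟨q, hqi, hq1⟩ := third i ⟨1, by omega⟩
    rw [hb a q i hai hqi, hb' i ⟨1, by omega⟩ q hqi hq1]
    exact hb q ⟨0, by omega⟩ ⟨1, by omega⟩ hq1 (by simp)
  obtain ⟨c, hc⟩ := hc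
  refine ⟨c, fun a i j k => ?_⟩
  by_cases hjk : j = k
  · subst hjk
    by_cases hai : a = i
    · subst hai
      by_cases haj : a = j
      · subst haj; simp only [hzero, if_true]; ring
      · simp [hzero, haj, hskew a j j a, hc a j haj]
    · have : t a j i j = 0 := by
        by_cases haj : a = j
        · subst haj; exact h1 i a (Ne.symm hai)
        · by_cases hij : i = j
          · subst hij; exact hzero _ _ _
          · exact (ha a i j hai haj hij).1
      rw [hzero, hskew a j j i, this]
      grind
  by_cases hij : i = j
  · subst hij
    by_cases hak : a = k
    · subst hak
      simp [hzero, hjk, Ne.symm hjk, hskew a i i a, hc a i (Ne.symm hjk)]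
    · have : t a i k i = 0 := by
        by_cases hai : a = i
        · subst hai; exact h1 k a (Ne.symm hjk)
        · exact (ha a k i hak hai (Ne.symm hjk)).1
      rw [hzero, hskew a i i k, this]
      grind
  by_cases hik : i = k
  · subst hik
    by_cases haj : a = j
    · subst haj
      simp [hc a i hjk, hjk, hij]; ring
    · have : t a i j i = 0 := by
        by_cases hai : a = i
        · subst hai; exact h1 j a (Ne.symm hij)
        · exact (ha a j i haj hai hjk).1
      simp [this, haj, hij, hjk]
  · have : t a i j k + t a k j i = 0 := by
      by_cases hai : a = i
      · subst hai
        obtain ⟨-, h3, h4⟩ := ha k j a (Ne.symm hjk) (Ne.symm hik) (Ne.symm hij)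
        rw [h3, h4, add_zero]
      by_cases hak : a = k
      · subst hak
        obtain ⟨-, h3, h4⟩ := ha i j a hij hik hjk
        rw [h3, h4, add_zero]
      exact hd a i j k hai hak hij hjk hik
    simp [this, hik, hij, hjk]

end InvariantTensors

/-! ### Schur's lemma, Casimir operators and conformal weights -/

/-- Schur's lemma for self-adjoint operators, over the reals or the complex numbers. -/
theorem IsIrreducibleSubspace.exists_eq_smul {𝕜 L T : Type*} [RCLike 𝕜] [NormedAddCommGroup T]
    [InnerProductSpace 𝕜 T] [FiniteDimensional 𝕜 T] {φ : L → T →ₗ[𝕜] T} {W : Submodule 𝕜 T}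
    (hW : IsIrreducibleSubspace (fun X t => φ X t) W) {S : T →ₗ[𝕜] T} (hS : S.IsSymmetric)
    (hSW : ∀ t ∈ W, S t ∈ W) (hcomm : ∀ X, ∀ t ∈ W, S (φ X t) = φ X (S t)) :
    ∃ w : ℝ, ∀ t ∈ W, S t = (w : 𝕜) • t := by
  have : Nontrivial W := (Submodule.nontrivial_iff_ne_bot).2 hW.ne_bot
  have hres := hS.restrict_invariant hSW
  -- A symmetric operator on a nonzero finite-dimensional space has a real eigenvalue over `ℝ` as
  -- well as over `ℂ`, so algebraic closedness is not needed.
  obtain ⟨w, hw⟩ : ∃ w : ℝ, Module.End.HasEigenvalue (S.restrict hSW) (w : 𝕜) :=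
    ⟨_, hres.hasEigenvalue_iSup_of_finiteDimensional⟩
  obtain ⟨v, hv⟩ := hw.exists_hasEigenvector
  let U : Submodule 𝕜 T := W ⊓ LinearMap.ker (S - (w : 𝕜) • LinearMap.id)
  have hmem : ∀ t, t ∈ U ↔ t ∈ W ∧ S t = (w : 𝕜) • t := fun t => by
    simp [U, sub_eq_zero]
  have hU := hW.eq_bot_or_eq U inf_le_left fun X t ht => by
    rw [hmem] at ht ⊢
    exact ⟨hW.invariant X t ht.1, by rw [hcomm X t ht.1, ht.2, map_smul]⟩
  have hvU : (v : T) ∈ U := by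
    rw [hmem]
    exact ⟨v.2, by simpa using congrArg Subtype.val hv.apply_eq_smul⟩
  rcases hU with hU | hU
  · rw [hU, Submodule.mem_bot] at hvU
    exact absurd (Subtype.ext hvU) hv.2
  · exact ⟨w, fun t ht => ((hmem t).1 (hU ▸ ht)).2⟩

section Wedge

variable {n : ℕ}

theorem wedge_apply (u v : Eucl n) (k j : Fin n) :
    (wedge u v : Matrix (Fin n) (Fin n) ℝ) k j = u j * v k - v j * u k := rfl

theorem wedge_swap (u v : Eucl n) : wedge u v = -wedge v u := by
  ext k j
  simp [wedge_apply]

theorem skew_apply (X : SO n) (i j : Fin n) :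
    (X : Matrix (Fin n) (Fin n) ℝ) i j = -(X : Matrix (Fin n) (Fin n) ℝ) j i := by
  have := congrFun (congrFun ((LieAlgebra.Orthogonal.mem_so _ _ _).1 X.2) j) i
  simpa using this

/-- The bracket is a derivation, `[X, u ∧ v] = Xu ∧ v + u ∧ Xv`. Through `ρ` this supplies the
commutation relations used for `B`, the Casimir operator and the trace tensor. -/
theorem lie_wedge (X : SO n) (i j : Fin n) :
    ⁅X, wedge (stdVec i) (stdVec j)⁆ =
      ∑ k, ((X : Matrix (Fin n) (Fin n) ℝ) k i • wedge (stdVec k) (stdVec j) +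
        (X : Matrix (Fin n) (Fin n) ℝ) k j • wedge (stdVec i) (stdVec k)) := by
  ext p q
  have h : ((∑ k, ((X : Matrix (Fin n) (Fin n) ℝ) k i • wedge (stdVec k) (stdVec j) +
        (X : Matrix (Fin n) (Fin n) ℝ) k j • wedge (stdVec i) (stdVec k)) : SO n) :
        Matrix (Fin n) (Fin n) ℝ) p q = ∑ k, ((X : Matrix (Fin n) (Fin n) ℝ) k i *
        (wedge (stdVec k) (stdVec j) : Matrix (Fin n) (Fin n) ℝ) p q +
        (X : Matrix (Fin n) (Fin n) ℝ) k j *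
        (wedge (stdVec i) (stdVec k) : Matrix (Fin n) (Fin n) ℝ) p q) := by
    rw [AddSubmonoidClass.coe_finsetSum, Matrix.sum_apply]
    rfl
  rw [h, LieSubalgebra.coe_bracket, Ring.lie_def, Matrix.sub_apply, Matrix.mul_apply,
    Matrix.mul_apply]
  simp only [wedge_apply, stdVec_apply, mul_sub, sub_mul, mul_ite, ite_mul, mul_one, one_mul,
    mul_zero, zero_mul, Finset.sum_sub_distrib, Finset.sum_add_distrib, Finset.sum_ite_eq,
    Finset.sum_ite_eq', Finset.mem_univ, if_true]
  by_cases h1 : p = j <;> by_cases h2 : p = i <;> simp [h1, h2, skew_apply X q] <;> split_ifs <;> ring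

end Wedge

section Casimir

variable {n : ℕ} {𝕜 : Type*} [RCLike 𝕜] {V : Type*} [NormedAddCommGroup V] [InnerProductSpace 𝕜 V]
  [Module ℝ V] [IsScalarTower ℝ 𝕜 V]

/-- The real structure on `V` is a separate datum; the scalar tower forces it to be the restriction
of the given one. -/
theorem real_smul_eq (r : ℝ) (v : V) : r • v = (r : 𝕜) • v := by
  rw [← algebraMap_smul 𝕜 r v, RCLike.algebraMap_eq_ofReal]

/-- The operator `ρ(e_i ∧ e_j)`. -/
noncomputable def rhoWedge (ρ : SO n →ₗ⁅ℝ⁆ Module.End 𝕜 V) (i j : Fin n) : Module.End 𝕜 V :=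
  ρ (wedge (stdVec i) (stdVec j))

theorem rhoWedge_swap (ρ : SO n →ₗ⁅ℝ⁆ Module.End 𝕜 V) (i j : Fin n) :
    rhoWedge ρ i j = -rhoWedge ρ j i := by
  rw [rhoWedge, wedge_swap, map_neg, rhoWedge]

theorem rho_rhoWedge (ρ : SO n →ₗ⁅ℝ⁆ Module.End 𝕜 V) (X : SO n) (i j : Fin n) (v : V) :
    ρ X (rhoWedge ρ i j v) = rhoWedge ρ i j (ρ X v) +
      ∑ k, (((X : Matrix (Fin n) (Fin n) ℝ) k i : 𝕜) • rhoWedge ρ k j v +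
        ((X : Matrix (Fin n) (Fin n) ℝ) k j : 𝕜) • rhoWedge ρ i k v) := by
  have h := congrArg (fun Y => ρ Y v) (lie_wedge X i j)
  simp only [LieHom.map_lie, Ring.lie_def, map_sum, map_add, map_smul, LinearMap.sub_apply,
    LinearMap.sum_apply, LinearMap.add_apply, LinearMap.smul_apply, Module.End.mul_apply,
    real_smul_eq (𝕜 := 𝕜)] at h
  rw [← sub_eq_iff_eq_add']
  exact h

/-- The action of `so(n)` on `ℝⁿ ⊗ V` by linear maps. -/
noncomputable def tensorActionLin (ρ : SO n →ₗ⁅ℝ⁆ Module.End 𝕜 V) (X : SO n) :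
    RnTensor n V →ₗ[𝕜] RnTensor n V where
  toFun := tensorAction ρ X
  map_add' s t := by
    ext i
    simp [tensorAction, Finset.sum_add_distrib]
    abel
  map_smul' c t := by
    ext i
    simp [tensorAction, Finset.smul_sum, smul_comm c]

/-- The conformal weight operator as a linear map. -/
noncomputable def confWeightLin (ρ : SO n →ₗ⁅ℝ⁆ Module.End 𝕜 V) :
    RnTensor n V →ₗ[𝕜] RnTensor n V where
  toFun := confWeightOp ρ
  map_add' s t := by
    ext i
    simp [confWeightOp, Finset.sum_add_distrib]
  map_smul' c t := by
    ext i
    simp [confWeightOp, Finset.smul_sum]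

theorem tensorAction_apply (ρ : SO n →ₗ⁅ℝ⁆ Module.End 𝕜 V) (X : SO n) (t : RnTensor n V)
    (i : Fin n) : tensorAction ρ X t i =
      ∑ j, (((X : Matrix (Fin n) (Fin n) ℝ) i j : ℝ) : 𝕜) • t j + ρ X (t i) := rfl

theorem confWeightOp_apply (ρ : SO n →ₗ⁅ℝ⁆ Module.End 𝕜 V) (t : RnTensor n V)
    (i : Fin n) : confWeightOp ρ t i = ∑ j, rhoWedge ρ i j (t j) := rfl

/-- The sign from the skewness of `ρ` is absorbed by exchanging the two vectors of the wedge. This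
makes `B` and the Casimir operator symmetric. -/
theorem rhoWedge_skew {ρ : SO n →ₗ⁅ℝ⁆ Module.End 𝕜 V} (hρ : IsIrreducibleOrthogonal ρ)
    (i j : Fin n) (v w : V) :
    inner 𝕜 (rhoWedge ρ i j v) w = inner 𝕜 v (rhoWedge ρ j i w) := by
  rw [rhoWedge_swap ρ j i, LinearMap.neg_apply, inner_neg_right]
  exact hρ.skew _ _ _

theorem confWeightLin_isSymmetric {ρ : SO n →ₗ⁅ℝ⁆ Module.End 𝕜 V}
    (hρ : IsIrreducibleOrthogonal ρ) : (confWeightLin ρ).IsSymmetric := by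
  intro s t
  change inner 𝕜 (confWeightOp ρ s) t = inner 𝕜 s (confWeightOp ρ t)
  simp only [PiLp.inner_apply, confWeightOp_apply, sum_inner, inner_sum, rhoWedge_skew hρ]
  exact Finset.sum_comm

theorem confWeightOp_tensorAction (ρ : SO n →ₗ⁅ℝ⁆ Module.End 𝕜 V) (X : SO n)
    (t : RnTensor n V) :
    confWeightOp ρ (tensorAction ρ X t) = tensorAction ρ X (confWeightOp ρ t) := by
  ext k
  simp only [confWeightOp_apply, tensorAction_apply, map_add, map_sum, map_smul, rho_rhoWedge,
    Finset.sum_add_distrib, Finset.smul_sum]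
  -- Since `X` is skew, rotating the outer index cancels the bracket term of the first wedge index;
  -- `h2` matches the inner index with the second one.
  have h1 : ∑ x, ∑ y, (((X : Matrix (Fin n) (Fin n) ℝ) k x : ℝ) : 𝕜) • rhoWedge ρ x y (t y) =
      -∑ x, ∑ y, (((X : Matrix (Fin n) (Fin n) ℝ) y k : ℝ) : 𝕜) • rhoWedge ρ y x (t x) := by
    rw [Finset.sum_comm, ← Finset.sum_neg_distrib]
    refine Finset.sum_congr rfl fun x _ => ?_
    rw [← Finset.sum_neg_distrib]
    refine Finset.sum_congr rfl fun y _ => ?_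
    rw [skew_apply X k y]
    simp
  have h2 : ∑ x, ∑ y, (((X : Matrix (Fin n) (Fin n) ℝ) x y : ℝ) : 𝕜) • rhoWedge ρ k x (t y) =
      ∑ x, ∑ y, (((X : Matrix (Fin n) (Fin n) ℝ) y x : ℝ) : 𝕜) • rhoWedge ρ k y (t x) :=
    Finset.sum_comm
  rw [h1, h2]
  abel

/-- The Casimir operator `∑_{i,j} ρ(e_i ∧ e_j)²`. -/
noncomputable def casimir (ρ : SO n →ₗ⁅ℝ⁆ Module.End 𝕜 V) : V →ₗ[𝕜] V :=
  ∑ i, ∑ j, rhoWedge ρ i j * rhoWedge ρ i j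

theorem casimir_apply (ρ : SO n →ₗ⁅ℝ⁆ Module.End 𝕜 V) (v : V) :
    casimir ρ v = ∑ i, ∑ j, rhoWedge ρ i j (rhoWedge ρ i j v) := by
  simp [casimir, LinearMap.sum_apply]

theorem casimir_isSymmetric {ρ : SO n →ₗ⁅ℝ⁆ Module.End 𝕜 V} (hρ : IsIrreducibleOrthogonal ρ) :
    (casimir ρ).IsSymmetric := by
  intro v w
  simp only [casimir_apply, sum_inner, inner_sum, rhoWedge_skew hρ]
  exact Finset.sum_comm

theorem casimir_rho (ρ : SO n →ₗ⁅ℝ⁆ Module.End 𝕜 V) (X : SO n) (v : V) :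
    casimir ρ (ρ X v) = ρ X (casimir ρ v) := by
  simp only [casimir_apply, map_sum, rho_rhoWedge, map_add, map_smul, Finset.sum_add_distrib]
  -- The commutator is a contraction of the skew matrix `X` with expressions symmetric in the same
  -- two indices, hence zero.
  have key : ∀ f : Fin n → Fin n → Fin n → V, (∀ i j k, f i j k = f k j i) →
      ∑ i, ∑ j, ∑ k, (((X : Matrix (Fin n) (Fin n) ℝ) k i : ℝ) : 𝕜) • f i j k = 0 := by
    intro f hf
    have : ∑ i, ∑ j, ∑ k, (((X : Matrix (Fin n) (Fin n) ℝ) k i : ℝ) : 𝕜) • f i j k =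
        -∑ i, ∑ j, ∑ k, (((X : Matrix (Fin n) (Fin n) ℝ) k i : ℝ) : 𝕜) • f i j k := by
      conv_lhs => rw [Finset.sum_comm]
      conv_rhs => rw [Finset.sum_comm]
      rw [← Finset.sum_neg_distrib]
      refine Finset.sum_congr rfl fun j _ => ?_
      conv_lhs => rw [Finset.sum_comm]
      rw [← Finset.sum_neg_distrib]
      refine Finset.sum_congr rfl fun i _ => ?_
      rw [← Finset.sum_neg_distrib]
      refine Finset.sum_congr rfl fun k _ => ?_
      rw [skew_apply X i k, hf]
      simp
    have h2 : (2 : 𝕜) • ∑ i, ∑ j, ∑ k,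
        (((X : Matrix (Fin n) (Fin n) ℝ) k i : ℝ) : 𝕜) • f i j k = 0 := by
      rw [two_smul]
      nth_rewrite 1 [this]
      exact neg_add_cancel _
    exact (smul_eq_zero.1 h2).resolve_left two_ne_zero
  have k1 := key (fun i j k => rhoWedge ρ i j (rhoWedge ρ k j v) + rhoWedge ρ k j (rhoWedge ρ i j v))
    fun i j k => add_comm _ _
  have k2 := key (fun i j k => rhoWedge ρ j i (rhoWedge ρ j k v) + rhoWedge ρ j k (rhoWedge ρ j i v))
    fun i j k => add_comm _ _
  rw [Finset.sum_comm] at k2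
  simp only [smul_add, Finset.sum_add_distrib] at k1 k2
  rw [add_assoc, left_eq_add]
  linear_combination (norm := abel) k1 + k2

theorem tensorAction_skew {ρ : SO n →ₗ⁅ℝ⁆ Module.End 𝕜 V} (hρ : IsIrreducibleOrthogonal ρ) (X : SO n) (s t : RnTensor n V) :
    inner 𝕜 (tensorAction ρ X s) t = -inner 𝕜 s (tensorAction ρ X t) := by
  simp only [PiLp.inner_apply, tensorAction_apply, inner_add_left, inner_add_right, sum_inner,
    inner_sum, inner_smul_left, inner_smul_right, hρ.skew, RCLike.conj_ofReal,
    Finset.sum_add_distrib, Finset.sum_neg_distrib, neg_add]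
  congr 1
  rw [Finset.sum_comm, ← Finset.sum_neg_distrib]
  refine Finset.sum_congr rfl fun i _ => ?_
  rw [← Finset.sum_neg_distrib]
  refine Finset.sum_congr rfl fun j _ => ?_
  rw [skew_apply X j i]
  simp

end Casimir

section ConformalWeight

variable {n : ℕ} {𝕜 : Type*} [RCLike 𝕜] {V : Type*} [NormedAddCommGroup V] [InnerProductSpace 𝕜 V]
  [Module ℝ V] [IsScalarTower ℝ 𝕜 V]

theorem exists_casimir_eq [FiniteDimensional 𝕜 V] {ρ : SO n →ₗ⁅ℝ⁆ Module.End 𝕜 V}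
    (hρ : IsIrreducibleOrthogonal ρ) : ∃ c : ℝ, ∀ v, casimir ρ v = (c : 𝕜) • v := by
  obtain ⟨c, hc⟩ := IsIrreducibleSubspace.exists_eq_smul (φ := fun X => ρ X) hρ.irreducible
    (casimir_isSymmetric hρ) (fun _ _ => Submodule.mem_top) (fun X t _ => casimir_rho ρ X t)
  exact ⟨c, fun v => hc v Submodule.mem_top⟩

theorem tensorAction_wedge_apply (ρ : SO n →ₗ⁅ℝ⁆ Module.End 𝕜 V) (i j : Fin n)
    (t : RnTensor n V) (k : Fin n) :
    tensorAction ρ (wedge (stdVec i) (stdVec j)) t k =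
      (if k = j then t i else 0) - (if k = i then t j else 0) + rhoWedge ρ i j (t k) := by
  rw [tensorAction_apply, rhoWedge]
  congr 1
  simp only [wedge_apply, stdVec_apply]
  push_cast
  simp only [sub_smul, Finset.sum_sub_distrib, ite_mul, one_mul, zero_mul, ite_smul, one_smul,
    zero_smul, Finset.sum_ite_eq', Finset.mem_univ, if_true, RCLike.ofReal_zero, RCLike.ofReal_one,
    apply_ite (RCLike.ofReal (K := 𝕜))]

/-- Squaring `X ⊗ 1 + 1 ⊗ ρ(X)` and summing yields the Casimir operator of `V`, that of `ℝⁿ`, which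
is the scalar `-2(n - 1)`, and twice the mixed term, which amounts to `-4B`. -/
theorem sum_tensorAction_wedge_sq (ρ : SO n →ₗ⁅ℝ⁆ Module.End 𝕜 V) (t : RnTensor n V) (k : Fin n) :
    (∑ i, ∑ j, tensorAction ρ (wedge (stdVec i) (stdVec j))
      (tensorAction ρ (wedge (stdVec i) (stdVec j)) t)) k =
      casimir ρ (t k) - (4 : 𝕜) • confWeightOp ρ t k - (2 * ((n : 𝕜) - 1)) • t k := by
  have hP : ∀ i, rhoWedge ρ i k (t i) = -rhoWedge ρ k i (t i) := fun i => by
    rw [rhoWedge_swap, LinearMap.neg_apply]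
  simp only [WithLp.ofLp_sum, Finset.sum_apply, tensorAction_wedge_apply, map_add, map_sub,
    Finset.sum_add_distrib, Finset.sum_sub_distrib, apply_ite (rhoWedge ρ _ _), map_zero,
    Finset.sum_ite_eq, Finset.sum_ite_eq', Finset.mem_univ, if_true, Finset.sum_ite_irrel, Finset.sum_const_zero,
    casimir_apply, confWeightOp_apply, hP, Finset.sum_neg_distrib, Finset.sum_const,
    Finset.card_univ, Fintype.card_fin]
  simp only [← Nat.cast_smul_eq_nsmul 𝕜]
  module

theorem IsIrreducibleDecomposition.exists_confWeight [FiniteDimensional 𝕜 V]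
    {ρ : SO n →ₗ⁅ℝ⁆ Module.End 𝕜 V} (hρ : IsIrreducibleOrthogonal ρ)
    {W : Submodule 𝕜 (RnTensor n V)} (hW : IsIrreducibleSubspace (tensorAction ρ) W) :
    ∃ w : ℝ, ∀ t ∈ W, confWeightOp ρ t = (w : 𝕜) • t := by
  obtain ⟨c, hc⟩ := exists_casimir_eq hρ
  refine IsIrreducibleSubspace.exists_eq_smul (φ := tensorActionLin ρ) (S := confWeightLin ρ) hW
    (confWeightLin_isSymmetric hρ) (fun t ht => ?_) (fun X t _ => confWeightOp_tensorAction ρ X t)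
  -- Commuting with the action does not by itself make `B` map `W` into itself. Solving the Casimir
  -- identity for `B` does: the Casimir operator of `V` is a scalar, and that of `ℝⁿ ⊗ V` is built
  -- from the action.
  have key : confWeightOp ρ t = (4 : 𝕜)⁻¹ • ((c : 𝕜) • t - (2 * ((n : 𝕜) - 1)) • t -
      ∑ i, ∑ j, tensorAction ρ (wedge (stdVec i) (stdVec j))
        (tensorAction ρ (wedge (stdVec i) (stdVec j)) t)) := by
    ext k
    simp only [PiLp.smul_apply, PiLp.sub_apply, sum_tensorAction_wedge_sq, hc]
    module
  change confWeightOp ρ t ∈ W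
  rw [key]
  refine W.smul_mem _ (W.sub_mem (W.sub_mem (W.smul_mem _ ht) (W.smul_mem _ ht)) ?_)
  exact W.sum_mem fun i _ => W.sum_mem fun j _ =>
    hW.invariant _ _ (hW.invariant _ _ ht)

theorem confWeightOp_eq_confWeight_smul [FiniteDimensional 𝕜 V]
    {ρ : SO n →ₗ⁅ℝ⁆ Module.End 𝕜 V} (hρ : IsIrreducibleOrthogonal ρ)
    {W : Submodule 𝕜 (RnTensor n V)} (hW : IsIrreducibleSubspace (tensorAction ρ) W) :
    ∀ t ∈ W, confWeightOp ρ t = (confWeight ρ W : 𝕜) • t := by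
  have h := IsIrreducibleDecomposition.exists_confWeight hρ hW
  rw [confWeight, dif_pos h]
  exact h.choose_spec

end ConformalWeight

/-! ### Equivariant operators on `ℝⁿ ⊗ V` and their trace tensor -/

theorem starProjection_apply_comm {𝕜 T : Type*} [RCLike 𝕜] [NormedAddCommGroup T]
    [InnerProductSpace 𝕜 T] {W : Submodule 𝕜 T} [W.HasOrthogonalProjection] {S : T → T}
    (hadd : ∀ s t, S (s - t) = S s - S t) (hW : ∀ t ∈ W, S t ∈ W)
    (hWo : ∀ t ∈ Wᗮ, S t ∈ Wᗮ) (t : T) :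
    W.starProjection (S t) = S (W.starProjection t) := by
  refine (Submodule.eq_starProjection_of_mem_orthogonal (hW _ (W.starProjection_apply_mem t)) ?_)
  rw [← hadd]
  exact hWo _ (W.sub_starProjection_mem_orthogonal t)

section TraceTensor

variable {n : ℕ} {𝕜 : Type*} [RCLike 𝕜] {V : Type*} [NormedAddCommGroup V] [InnerProductSpace 𝕜 V]

/-- The map `v ↦ e_i ⊗ v`. -/
noncomputable def tensorSingle (𝕜 : Type*) [RCLike 𝕜] {V : Type*} [NormedAddCommGroup V]
    [InnerProductSpace 𝕜 V] (i : Fin n) : V →ₗ[𝕜] RnTensor n V where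
  toFun v := WithLp.toLp 2 fun k => if k = i then v else 0
  map_add' v w := by
    ext k
    by_cases h : k = i <;> simp [h]
  map_smul' c v := by
    ext k
    by_cases h : k = i <;> simp [h]

theorem tensorSingle_apply (i : Fin n) (v : V) (k : Fin n) :
    tensorSingle 𝕜 i v k = if k = i then v else 0 := rfl

theorem sum_tensorSingle (t : RnTensor n V) : ∑ i, tensorSingle 𝕜 i (t i) = t := by
  ext k
  simp [WithLp.ofLp_sum, Finset.sum_apply, tensorSingle_apply]

/-- The blocks `A_{ai} ∈ End V` of an endomorphism `A` of `ℝⁿ ⊗ V`. -/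
noncomputable def blockOp (A : RnTensor n V →ₗ[𝕜] RnTensor n V) (a i : Fin n) : Module.End 𝕜 V where
  toFun v := A (tensorSingle 𝕜 i v) a
  map_add' v w := by simp
  map_smul' c v := by simp

theorem blockOp_apply (A : RnTensor n V →ₗ[𝕜] RnTensor n V) (a i : Fin n) (v : V) :
    blockOp A a i v = A (tensorSingle 𝕜 i v) a := rfl

theorem apply_eq_sum_blockOp (A : RnTensor n V →ₗ[𝕜] RnTensor n V) (t : RnTensor n V) (a : Fin n) :
    A t a = ∑ i, blockOp A a i (t i) := by
  conv_lhs => rw [← sum_tensorSingle (𝕜 := 𝕜) t]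
  simp [WithLp.ofLp_sum, Finset.sum_apply, blockOp_apply]

theorem trace_eq_sum_trace_blockOp [FiniteDimensional 𝕜 V] (A : RnTensor n V →ₗ[𝕜] RnTensor n V) :
    LinearMap.trace 𝕜 _ A = ∑ i, LinearMap.trace 𝕜 V (blockOp A i i) := by
  let b := stdOrthonormalBasis 𝕜 V
  rw [LinearMap.trace_eq_sum_inner _ (Pi.orthonormalBasis fun _ : Fin n => b)]
  rw [Fintype.sum_sigma]
  refine Finset.sum_congr rfl fun i _ => ?_
  rw [LinearMap.trace_eq_sum_inner _ b]
  refine Finset.sum_congr rfl fun k _ => ?_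
  have h : (Pi.orthonormalBasis fun _ : Fin n => b) ⟨i, k⟩ = tensorSingle 𝕜 i (b k) := by
    rw [Pi.orthonormalBasis_apply]
    ext l
    by_cases h : l = i
    · subst h; simp [tensorSingle_apply]
    · simp [tensorSingle_apply, h]
  rw [h, PiLp.inner_apply, blockOp_apply, Finset.sum_eq_single i]
  · simp [tensorSingle_apply]
  · intro l _ hl
    simp [tensorSingle_apply, hl]
  · simp

variable [Module ℝ V] [IsScalarTower ℝ 𝕜 V]

theorem tensorAction_tensorSingle (ρ : SO n →ₗ⁅ℝ⁆ Module.End 𝕜 V) (X : SO n) (i : Fin n) (v : V) :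
    tensorAction ρ X (tensorSingle 𝕜 i v) =
      ∑ b, ((X : Matrix (Fin n) (Fin n) ℝ) b i : 𝕜) • tensorSingle 𝕜 b v +
        tensorSingle 𝕜 i (ρ X v) := by
  ext k
  simp [tensorAction_apply, WithLp.ofLp_sum, Finset.sum_apply, tensorSingle_apply,
    apply_ite (ρ X)]

/-- Equivariance of `A`, read off in the component `a` of its value on `e_i ⊗ v`; the skewness of
`X` puts the rotated outer index in the same form as the inner one. -/
theorem blockOp_comm {ρ : SO n →ₗ⁅ℝ⁆ Module.End 𝕜 V} {A : RnTensor n V →ₗ[𝕜] RnTensor n V}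
    (hA : ∀ X t, A (tensorAction ρ X t) = tensorAction ρ X (A t)) (X : SO n) (a i : Fin n) :
    ∑ b, ((X : Matrix (Fin n) (Fin n) ℝ) b i : 𝕜) • blockOp A a b + blockOp A a i * ρ X =
      ρ X * blockOp A a i - ∑ b, ((X : Matrix (Fin n) (Fin n) ℝ) b a : 𝕜) • blockOp A b i := by
  ext v
  have h := congrArg (fun t : RnTensor n V => t a) (hA X (tensorSingle 𝕜 i v))
  simp only [tensorAction_tensorSingle, map_add, map_sum, map_smul, tensorAction_apply,
    PiLp.add_apply, WithLp.ofLp_sum, Finset.sum_apply, PiLp.smul_apply] at h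
  simp only [LinearMap.add_apply, LinearMap.sub_apply, LinearMap.sum_apply, LinearMap.smul_apply,
    Module.End.mul_apply, blockOp_apply]
  rw [h]
  simp only [skew_apply X a, RCLike.ofReal_neg, neg_smul, Finset.sum_neg_distrib]
  abel

/-- The tensor `tr_V(A_{ai} ρ(e_j ∧ e_k))`. -/
noncomputable def traceTensor (ρ : SO n →ₗ⁅ℝ⁆ Module.End 𝕜 V)
    (A : RnTensor n V →ₗ[𝕜] RnTensor n V) (a i j k : Fin n) : 𝕜 :=
  LinearMap.trace 𝕜 V (blockOp A a i * rhoWedge ρ j k)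

theorem traceTensor_skew (ρ : SO n →ₗ⁅ℝ⁆ Module.End 𝕜 V) (A : RnTensor n V →ₗ[𝕜] RnTensor n V)
    (a i j k : Fin n) : traceTensor ρ A a i j k = -traceTensor ρ A a i k j := by
  rw [traceTensor, rhoWedge_swap, mul_neg, map_neg, traceTensor]

/-- Multiply `blockOp_comm` by `ρ(e_j ∧ e_k)` and take traces: moving `ρ(X)` past the wedge rotates
`j` and `k`, and the remaining products with `ρ(X)` cancel by cyclicity of the trace. -/
theorem traceTensor_invariant {ρ : SO n →ₗ⁅ℝ⁆ Module.End 𝕜 V}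
    {A : RnTensor n V →ₗ[𝕜] RnTensor n V}
    (hA : ∀ X t, A (tensorAction ρ X t) = tensorAction ρ X (A t)) (X : SO n) (a i j k : Fin n) :
    ∑ b, ((X : Matrix (Fin n) (Fin n) ℝ) b a : 𝕜) * traceTensor ρ A b i j k +
      ∑ b, ((X : Matrix (Fin n) (Fin n) ℝ) b i : 𝕜) * traceTensor ρ A a b j k +
      ∑ b, ((X : Matrix (Fin n) (Fin n) ℝ) b j : 𝕜) * traceTensor ρ A a i b k +
      ∑ b, ((X : Matrix (Fin n) (Fin n) ℝ) b k : 𝕜) * traceTensor ρ A a i j b = 0 := by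
  have h1 := congrArg (fun F => LinearMap.trace 𝕜 V (F * rhoWedge ρ j k)) (blockOp_comm hA X a i)
  have h2 : ρ X * rhoWedge ρ j k = rhoWedge ρ j k * ρ X +
      ∑ b, (((X : Matrix (Fin n) (Fin n) ℝ) b j : 𝕜) • rhoWedge ρ b k +
        ((X : Matrix (Fin n) (Fin n) ℝ) b k : 𝕜) • rhoWedge ρ j b) := by
    ext v
    simp [rho_rhoWedge, LinearMap.sum_apply]
  simp only [add_mul, sub_mul, Finset.sum_mul, smul_mul_assoc, map_add, map_sub, map_sum, map_smul,
    smul_eq_mul, mul_assoc, h2, mul_add, Finset.mul_sum, mul_smul_comm,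
    Finset.sum_add_distrib] at h1
  rw [LinearMap.trace_mul_comm 𝕜 (ρ X), mul_assoc] at h1
  simp only [traceTensor]
  linear_combination h1

theorem exists_traceTensor_symmetrization (hn : 3 ≤ n) {ρ : SO n →ₗ⁅ℝ⁆ Module.End 𝕜 V}
    {A : RnTensor n V →ₗ[𝕜] RnTensor n V}
    (hA : ∀ X t, A (tensorAction ρ X t) = tensorAction ρ X (A t)) :
    ∃ c : 𝕜, ∀ a i j k, traceTensor ρ A a i j k + traceTensor ρ A a k j i =
      c * (2 * (if a = j then 1 else 0) * (if i = k then 1 else 0) -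
        (if a = k then 1 else 0) * (if i = j then 1 else 0) -
        (if a = i then 1 else 0) * (if j = k then 1 else 0)) := by
  refine exists_symmetrization_eq hn _ (traceTensor_skew ρ A) fun p q hpq a i j k => ?_
  have h := traceTensor_invariant hA (wedge (stdVec p) (stdVec q)) a i j k
  have e : ∀ (f : Fin n → 𝕜) (l : Fin n),
      ∑ b, ((wedge (stdVec p) (stdVec q) : Matrix (Fin n) (Fin n) ℝ) b l : 𝕜) * f b =
        (if l = p then f q else 0) - if l = q then f p else 0 := by
    intro f l
    simp only [wedge_apply, stdVec_apply]
    by_cases h1 : l = p <;> by_cases h2 : l = q <;>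
      simp [h1, h2, sub_mul, Finset.sum_sub_distrib, apply_ite (RCLike.ofReal (K := 𝕜))]
  simpa only [e] using h

end TraceTensor

/-! ### Contraction with the linearized connection form -/

/-- The contraction of an invariant tensor with the linearized connection form. -/
theorem sum_skew_mul_eq {n : ℕ} {𝕜 : Type*} [Field 𝕜] [CharZero 𝕜]
    {t : Fin n → Fin n → Fin n → Fin n → 𝕜} (hskew : ∀ a i j k, t a i j k = -t a i k j) {c : 𝕜}
    (hsym : ∀ a i j k, t a i j k + t a k j i =
      c * (2 * (if a = j then 1 else 0) * (if i = k then 1 else 0) -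
        (if a = k then 1 else 0) * (if i = j then 1 else 0) -
        (if a = i then 1 else 0) * (if j = k then 1 else 0)))
    {D : Fin n → Fin n → Fin n → 𝕜} (hD : ∀ j i k, D j i k = D j k i) (a : Fin n) :
    ∑ i, ∑ j, ∑ k, (if j < k then (1 / 2 : 𝕜) * (D j i k - D k i j) * t a i j k else 0) =
      -(c / 2) * ∑ i, (D i i a - D a i i) := by
  -- By skewness of `t` in `j, k`, the sum over `j < k` is half the sum over all pairs, and the two
  -- terms of `D j i k - D k i j` contribute equally.
  have h1 : ∀ i, ∑ j, ∑ k, D j i k * t a i j k =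
      2 * ∑ j, ∑ k, (if j < k then (1 / 2 : 𝕜) * (D j i k - D k i j) * t a i j k else 0) := by
    intro i
    set f : Fin n → Fin n → 𝕜 :=
      fun j k => if j < k then (1 / 2 : 𝕜) * (D j i k - D k i j) * t a i j k else 0 with hf
    have e1 : ∀ j k, (1 / 2 : 𝕜) * (D j i k - D k i j) * t a i j k = f j k + f k j := by
      intro j k
      rcases lt_trichotomy j k with h | h | h
      · simp [hf, h, h.not_gt]
      · simp [hf, h]
      · simp only [hf, h, h.not_gt, if_true, if_false, zero_add]
        rw [hskew a i k j]
        ring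
    have e2 : ∑ j, ∑ k, (1 / 2 : 𝕜) * (D j i k - D k i j) * t a i j k = 2 * ∑ j, ∑ k, f j k := by
      simp only [e1, Finset.sum_add_distrib]
      rw [Finset.sum_comm (f := fun j k => f k j)]
      ring
    have e3 : ∑ j, ∑ k, (1 / 2 : 𝕜) * (D j i k - D k i j) * t a i j k =
        ∑ j, ∑ k, D j i k * t a i j k := by
      have : ∑ j, ∑ k, D k i j * t a i j k = -∑ j, ∑ k, D j i k * t a i j k := by
        rw [Finset.sum_comm, ← Finset.sum_neg_distrib]
        refine Finset.sum_congr rfl fun j _ => ?_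
        rw [← Finset.sum_neg_distrib]
        refine Finset.sum_congr rfl fun k _ => ?_
        rw [hskew a i k j]
        ring
      calc _ = (1 / 2 : 𝕜) * (∑ j, ∑ k, D j i k * t a i j k -
            ∑ j, ∑ k, D k i j * t a i j k) := by
            simp only [← Finset.sum_sub_distrib, Finset.mul_sum]
            refine Finset.sum_congr rfl fun j _ => Finset.sum_congr rfl fun k _ => ?_
            ring
        _ = _ := by rw [this]; ring
    rw [← e3, e2]
  -- The symmetry of `D` exchanges `i` and `k` in `t`, so only the symmetrization matters.
  have h2 : ∑ i, ∑ j, ∑ k, D j i k * t a i j k = ∑ i, ∑ j, ∑ k, D j i k * t a k j i := by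
    rw [Finset.sum_comm]
    conv_rhs => rw [Finset.sum_comm]
    refine Finset.sum_congr rfl fun j _ => ?_
    rw [Finset.sum_comm]
    refine Finset.sum_congr rfl fun i _ => Finset.sum_congr rfl fun k _ => ?_
    rw [hD]
  have h3 : 2 * ∑ i, ∑ j, ∑ k, D j i k * t a i j k = -(2 * c) * ∑ i, (D i i a - D a i i) := by
    rw [two_mul]
    nth_rewrite 2 [h2]
    simp only [← Finset.sum_add_distrib, ← mul_add, hsym]
    have : ∀ i j k, D j i k * (c * (2 * (if a = j then 1 else 0) * (if i = k then 1 else 0) -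
        (if a = k then 1 else 0) * (if i = j then 1 else 0) -
        (if a = i then 1 else 0) * (if j = k then 1 else 0))) =
        (if a = j then if i = k then 2 * c * D j i k else 0 else 0) -
        (if i = j then if a = k then c * D j i k else 0 else 0) -
        (if a = i then if j = k then c * D j i k else 0 else 0) := by
      intro i j k
      split_ifs <;> ring
    simp only [this, Finset.sum_sub_distrib, Finset.sum_ite_irrel, Finset.sum_const_zero,
      Finset.sum_ite_eq, Finset.mem_univ, if_true, ← Finset.mul_sum]
    simp only [hD _ a]
    ring
  have h4 : ∑ i, ∑ j, ∑ k, D j i k * t a i j k = 2 * ∑ i, ∑ j, ∑ k,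
      (if j < k then (1 / 2 : 𝕜) * (D j i k - D k i j) * t a i j k else 0) := by
    simp only [h1, Finset.mul_sum]
  have h5 : (4 : 𝕜) ≠ 0 := by norm_num
  apply mul_left_cancel₀ h5
  linear_combination h3 - 2 * h4

theorem rhoConn_apply {n : ℕ} {𝕜 : Type*} [RCLike 𝕜] {V : Type*} [NormedAddCommGroup V]
    [InnerProductSpace 𝕜 V] [Module ℝ V] [IsScalarTower ℝ 𝕜 V] {ρ : SO n →ₗ⁅ℝ⁆ Module.End 𝕜 V}
    (G : Eucl n → Matrix (Fin n) (Fin n) ℝ) (v : V) (x : Eucl n) (i : Fin n) :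
    rhoConn ρ G v x i =
      ∑ j, ∑ k, if j < k then (connCoeff G x i j k : 𝕜) • rhoWedge ρ j k v else 0 := by
  change ρ (connForm G x i) v = _
  simp only [connForm, map_sum, LinearMap.sum_apply, apply_ite ρ, map_smul, map_zero]
  refine Finset.sum_congr rfl fun j _ => Finset.sum_congr rfl fun k _ => ?_
  split_ifs
  · rw [LinearMap.smul_apply, real_smul_eq (𝕜 := 𝕜), rhoWedge]
  · rfl

/-! ### The operator `A` and the value of the constant -/

section WeightedProj

variable {n : ℕ} {𝕜 : Type*} [RCLike 𝕜] {V : Type*} [NormedAddCommGroup V] [InnerProductSpace 𝕜 V]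
  [FiniteDimensional 𝕜 V]

/-- The operator `A = ∑_j a_j Π_j` as a linear map. -/
noncomputable def weightedProjLin {ι : Type*} [Fintype ι]
    (W : ι → Submodule 𝕜 (RnTensor n V)) (a : ι → ℝ) : RnTensor n V →ₗ[𝕜] RnTensor n V :=
  ∑ j, ((a j : ℝ) : 𝕜) • ((W j).starProjection : RnTensor n V →ₗ[𝕜] RnTensor n V)

theorem weightedProjLin_apply {ι : Type*} [Fintype ι]
    (W : ι → Submodule 𝕜 (RnTensor n V)) (a : ι → ℝ) (t : RnTensor n V) :
    weightedProjLin W a t = weightedProj W a t := by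
  simp [weightedProjLin, weightedProj, LinearMap.sum_apply]

variable [Module ℝ V] [IsScalarTower ℝ 𝕜 V] {ρ : SO n →ₗ⁅ℝ⁆ Module.End 𝕜 V}

theorem weightedProjLin_tensorAction (hρ : IsIrreducibleOrthogonal ρ) {ι : Type*} [Fintype ι]
    {W : ι → Submodule 𝕜 (RnTensor n V)} (hW : IsIrreducibleDecomposition ρ W) (a : ι → ℝ)
    (X : SO n) (t : RnTensor n V) :
    weightedProjLin W a (tensorAction ρ X t) = tensorAction ρ X (weightedProjLin W a t) := by
  -- The orthogonal complement of `W j` is invariant too, because the action is skew.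
  have h : ∀ j, (W j).starProjection (tensorActionLin ρ X t) =
      tensorActionLin ρ X ((W j).starProjection t) := fun j =>
    starProjection_apply_comm (S := tensorActionLin ρ X) (map_sub _) ((hW.irreducible j).invariant X) (fun s hs => by
      rw [Submodule.mem_orthogonal] at hs ⊢
      intro u hu
      have := tensorAction_skew hρ X u s
      rw [hs _ ((hW.irreducible j).invariant X u hu), eq_comm, neg_eq_zero] at this
      exact this) t
  change _ = tensorActionLin ρ X _
  rw [weightedProjLin_apply, weightedProjLin_apply, weightedProj, weightedProj, map_sum]
  refine Finset.sum_congr rfl fun j _ => ?_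
  rw [map_smul, ← h j]
  rfl

/-- `B` commutes with each `Π_j` and is the scalar `w_j` on `W_j`, so `AB = ∑ a_j w_j Π_j`; the
trace of `Π_j` is `dim W_j`. -/
theorem trace_weightedProjLin_mul_confWeightLin (hρ : IsIrreducibleOrthogonal ρ) {ι : Type*}
    [Fintype ι] {W : ι → Submodule 𝕜 (RnTensor n V)} (hW : IsIrreducibleDecomposition ρ W)
    (a : ι → ℝ) : LinearMap.trace 𝕜 _ (weightedProjLin W a ∘ₗ confWeightLin ρ) =
      ((∑ j, a j * (Module.finrank 𝕜 (W j) * confWeight ρ (W j)) : ℝ) : 𝕜) := by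
  have hw := fun j => confWeightOp_eq_confWeight_smul hρ (hW.irreducible j)
  have h : ∀ j t, (W j).starProjection (confWeightLin ρ t) =
      confWeightLin ρ ((W j).starProjection t) := fun j t =>
    starProjection_apply_comm (map_sub _)
      (fun s hs => by
        change confWeightOp ρ s ∈ _
        rw [hw j s hs]
        exact (W j).smul_mem _ hs)
      (fun s hs => by
        rw [Submodule.mem_orthogonal] at hs ⊢
        intro u hu
        rw [← confWeightLin_isSymmetric hρ u s]
        change inner 𝕜 (confWeightOp ρ u) s = 0
        rw [hw j u hu, inner_smul_left, hs u hu, mul_zero]) t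
  have e : weightedProjLin W a ∘ₗ confWeightLin ρ = ∑ j, ((a j * confWeight ρ (W j) : ℝ) : 𝕜) •
      ((W j).starProjection : RnTensor n V →ₗ[𝕜] RnTensor n V) := by
    ext1 t
    rw [LinearMap.comp_apply, weightedProjLin, LinearMap.sum_apply, LinearMap.sum_apply]
    refine Finset.sum_congr rfl fun j _ => ?_
    simp only [LinearMap.smul_apply, ContinuousLinearMap.coe_coe, h]
    change _ • confWeightOp ρ _ = _
    rw [hw j _ ((W j).starProjection_apply_mem t), smul_smul, RCLike.ofReal_mul]
  have htr : ∀ j, LinearMap.trace 𝕜 _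
      ((W j).starProjection : RnTensor n V →ₗ[𝕜] RnTensor n V) = Module.finrank 𝕜 (W j) := fun j =>
    LinearMap.IsProj.trace ⟨fun t => (W j).starProjection_apply_mem t,
      fun t ht => Submodule.starProjection_eq_self_iff.2 ht⟩
  rw [e, map_sum]
  simp only [map_smul, htr, smul_eq_mul]
  push_cast
  refine Finset.sum_congr rfl fun j _ => ?_
  ring

/-- The blocks of `B` are `ρ(e_j ∧ e_i)`, so this contraction is the block form of `tr(AB)`. -/
theorem sum_traceTensor_eq (hρ : IsIrreducibleOrthogonal ρ) {ι : Type*}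
    [Fintype ι] {W : ι → Submodule 𝕜 (RnTensor n V)} (hW : IsIrreducibleDecomposition ρ W)
    (a : ι → ℝ) : ∑ i, ∑ j, traceTensor ρ (weightedProjLin W a) i j j i =
      ((∑ j, a j * (Module.finrank 𝕜 (W j) * confWeight ρ (W j)) : ℝ) : 𝕜) := by
  rw [← trace_weightedProjLin_mul_confWeightLin hρ hW, trace_eq_sum_trace_blockOp]
  refine Finset.sum_congr rfl fun i _ => ?_
  simp only [traceTensor]
  rw [← map_sum]
  congr 1
  ext v
  rw [blockOp_apply, LinearMap.comp_apply, apply_eq_sum_blockOp, LinearMap.sum_apply]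
  refine Finset.sum_congr rfl fun j _ => ?_
  rw [Module.End.mul_apply]
  congr 1
  change _ = confWeightOp ρ _ j
  simp [confWeightOp_apply, tensorSingle_apply, apply_ite (rhoWedge ρ _ _)]

/-- The symmetrization of the trace tensor of `A = ∑_j a_j Π_j`, in terms of `μ(a)`. -/
theorem traceTensor_symmetrization (hn : 3 ≤ n) (hρ : IsIrreducibleOrthogonal ρ) {ι : Type*}
    [Fintype ι] {W : ι → Submodule 𝕜 (RnTensor n V)} (hW : IsIrreducibleDecomposition ρ W)
    (α : ι → ℝ) (a i j k : Fin n) :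
    traceTensor ρ (weightedProjLin W α) a i j k + traceTensor ρ (weightedProjLin W α) a k j i =
      (2 * massConstant ρ W α : ℝ) * (2 * (if a = j then 1 else 0) * (if i = k then 1 else 0) -
        (if a = k then 1 else 0) * (if i = j then 1 else 0) -
        (if a = i then 1 else 0) * (if j = k then 1 else 0)) := by
  obtain ⟨c, hc⟩ := exists_traceTensor_symmetrization hn (weightedProjLin_tensorAction hρ hW α)
  -- When the second and fourth indices coincide, symmetrizing merely doubles the component. The sum
  -- over `i, j` is then `-c n(n - 1)`, to be compared with `tr(AB)`.
  have h1 : ∀ i j, traceTensor ρ (weightedProjLin W α) i j j i =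
      c * ((if i = j then 1 else 0) - 1) := by
    intro i j
    have := hc i j i j
    rw [traceTensor_skew]
    by_cases hij : i = j
    · simp [hij] at this ⊢
      linear_combination (1 / 2 : 𝕜) * this
    · simp [hij, Ne.symm hij] at this ⊢
      linear_combination (1 / 2 : 𝕜) * this
  have h2 := sum_traceTensor_eq hρ hW α
  simp only [h1, ← Finset.mul_sum, Finset.sum_sub_distrib, Finset.sum_ite_eq, Finset.mem_univ,
    if_true, Finset.sum_const, Finset.card_univ, Fintype.card_fin, nsmul_eq_mul, mul_one] at h2
  have hn0 : (n : ℝ) * ((n : ℝ) - 1) ≠ 0 := by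
    have : (3 : ℝ) ≤ n := by exact_mod_cast hn
    have h3 : 0 < (n : ℝ) := by linarith
    have h4 : 0 < (n : ℝ) - 1 := by linarith
    positivity
  have hn1 : (n : 𝕜) * ((n : 𝕜) - 1) ≠ 0 := by exact_mod_cast (RCLike.ofReal_ne_zero (K := 𝕜)).2 hn0
  have hcm : c = ((2 * massConstant ρ W α : ℝ) : 𝕜) := by
    have h5 : 2 * massConstant ρ W α * (n * ((n : ℝ) - 1)) =
        -∑ j, α j * (Module.finrank 𝕜 (W j) * confWeight ρ (W j)) := by
      rw [massConstant, mul_neg, neg_mul, Finset.mul_sum, Finset.sum_mul]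
      congr 1
      refine Finset.sum_congr rfl fun j _ => ?_
      have : (n : ℝ) ≠ 0 := left_ne_zero_of_mul hn0
      have : (n : ℝ) - 1 ≠ 0 := right_ne_zero_of_mul hn0
      field_simp
    apply mul_right_cancel₀ hn1
    have h6 := congrArg (RCLike.ofReal (K := 𝕜)) h5
    rw [RCLike.ofReal_neg, ← h2] at h6
    push_cast at h6 ⊢
    linear_combination -h6
  rw [hc, hcm]

/-- The sum over an orthonormal basis is a trace over `V`, which removes the dependence on the
basis. -/
theorem sum_inner_boundary {ι : Type*} [Fintype ι] (W : ι → Submodule 𝕜 (RnTensor n V))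
    (α : ι → ℝ) (G : Eucl n → Matrix (Fin n) (Fin n) ℝ) {κ : Type*} [Fintype κ]
    (σ : OrthonormalBasis κ 𝕜 V) (x ν : Eucl n) :
    ∑ l, inner 𝕜 (pureTensor 𝕜 ν (σ l)) (weightedProj W α (rhoConn ρ G (σ l) x)) =
      ∑ a, (ν a : 𝕜) * ∑ i, ∑ j, ∑ k, if j < k then
        (connCoeff G x i j k : 𝕜) * traceTensor ρ (weightedProjLin W α) a i j k else 0 := by
  simp only [PiLp.inner_apply, ← weightedProjLin_apply, apply_eq_sum_blockOp, rhoConn_apply]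
  rw [Finset.sum_comm]
  refine Finset.sum_congr rfl fun a _ => ?_
  simp only [traceTensor, LinearMap.trace_eq_sum_inner _ σ, pureTensor, inner_smul_left,
    RCLike.conj_ofReal, ← Finset.mul_sum, map_sum, inner_sum, apply_ite (blockOp _ _ _),
    map_zero, map_smul, Module.End.mul_apply]
  congr 1
  rw [Finset.sum_comm]
  refine Finset.sum_congr rfl fun i _ => ?_
  rw [Finset.sum_comm]
  refine Finset.sum_congr rfl fun j _ => ?_
  rw [Finset.sum_comm]
  refine Finset.sum_congr rfl fun k _ => ?_
  split_ifs
  · simp only [inner_smul_right, Finset.mul_sum]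
  · simp

end WeightedProj

/-! ### Rotations and integration over spheres -/

section SphereIntegral

variable {n : ℕ}

theorem integrable_sphere_of_continuous {F : Type*} [NormedAddCommGroup F]
    {f : sphere (0 : Eucl n) 1 → F} (hf : Continuous f) :
    Integrable f (volume : Measure (Eucl n)).toSphere := by
  exact hf.integrable_of_hasCompactSupport (HasCompactSupport.of_compactSpace f)

/-- Compactness of the sphere times a small closed interval supplies the constant bound for
differentiation under the integral. -/
theorem hasDerivAt_sphere_integral {h h' : ℝ → sphere (0 : Eucl n) 1 → ℝ} {s : Set ℝ}
    (hs : IsOpen s) (hd : ∀ t ∈ s, ∀ ν, HasDerivAt (fun t => h t ν) (h' t ν) t)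
    (hc : ∀ t ∈ s, Continuous (h t))
    (hc' : ContinuousOn (Function.uncurry h') (s ×ˢ Set.univ)) {t₀ : ℝ} (ht₀ : t₀ ∈ s) :
    HasDerivAt (fun t => ∫ ν, h t ν ∂(volume : Measure (Eucl n)).toSphere)
      (∫ ν, h' t₀ ν ∂(volume : Measure (Eucl n)).toSphere) t₀ := by
  obtain ⟨ε, hε, hball⟩ := Metric.nhds_basis_closedBall.mem_iff.1 (hs.mem_nhds ht₀)
  have hK : IsCompact (closedBall t₀ ε ×ˢ (Set.univ : Set (sphere (0 : Eucl n) 1))) :=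
    (isCompact_closedBall t₀ ε).prod isCompact_univ
  obtain ⟨C, hC⟩ := hK.exists_bound_of_continuousOn
    (hc'.mono (Set.prod_mono hball subset_rfl))
  have hc'' : ∀ t ∈ s, Continuous (h' t) := fun t ht =>
    hc'.comp_continuous (by fun_prop : Continuous fun ν => (t, ν)) fun ν => ⟨ht, trivial⟩
  refine (hasDerivAt_integral_of_dominated_loc_of_deriv_le (F := h) (F' := h')
    (bound := fun _ => C) (closedBall_mem_nhds t₀ hε) ?_ (integrable_sphere_of_continuous (hc t₀ ht₀))
    (integrable_sphere_of_continuous (hc'' t₀ ht₀)).aestronglyMeasurable ?_ ?_ ?_).2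
  · filter_upwards [hs.mem_nhds ht₀] with t ht
    exact (integrable_sphere_of_continuous (hc t ht)).aestronglyMeasurable
  · exact ae_of_all _ fun ν t ht => hC (t, ν) ⟨ht, trivial⟩
  · exact integrable_const _
  · exact ae_of_all _ fun ν t ht => hd t (hball ht) ν

/-- The action of a linear isometry on the unit sphere. -/
noncomputable def sphereMap (L : Eucl n ≃ₗᵢ[ℝ] Eucl n) (ν : sphere (0 : Eucl n) 1) :
    sphere (0 : Eucl n) 1 := ⟨L ν, by simp⟩

theorem continuous_sphereMap (L : Eucl n ≃ₗᵢ[ℝ] Eucl n) : Continuous (sphereMap L) :=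
  (L.continuous.comp continuous_subtype_val).subtype_mk _

/-- The sphere measure of a set is a multiple of the volume of the cone over it, and an isometry
maps cones to cones, preserving volume. -/
theorem measurePreserving_sphereMap (L : Eucl n ≃ₗᵢ[ℝ] Eucl n) :
    MeasurePreserving (sphereMap L) (volume : Measure (Eucl n)).toSphere
      (volume : Measure (Eucl n)).toSphere := by
  refine ⟨(continuous_sphereMap L).measurable, ?_⟩
  ext s hs
  rw [Measure.map_apply (continuous_sphereMap L).measurable hs, Measure.toSphere_apply' _ hs,
    Measure.toSphere_apply' _ ((continuous_sphereMap L).measurable hs)]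
  congr 1
  rw [← L.symm.measurePreserving.measure_preimage_emb L.symm.toHomeomorph.measurableEmbedding]
  congr 1
  ext x
  simp only [Set.mem_smul, Set.mem_image, Set.mem_preimage]
  constructor
  · rintro ⟨r, hr, _, ⟨ν, hν, rfl⟩, hx⟩
    refine ⟨r, hr, _, ⟨sphereMap L ν, hν, rfl⟩, ?_⟩
    apply L.symm.injective
    rw [← hx]
    simp [sphereMap]
  · rintro ⟨r, hr, _, ⟨ν, hν, rfl⟩, rfl⟩
    refine ⟨r, hr, _, ⟨sphereMap L.symm ν, ?_, rfl⟩, by simp [sphereMap]⟩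
    have : sphereMap L (sphereMap L.symm ν) = ν := Subtype.ext (by simp [sphereMap])
    rwa [this]

theorem integral_sphereMap (L : Eucl n ≃ₗᵢ[ℝ] Eucl n) (h : Eucl n → ℝ) :
    ∫ ν : sphere (0 : Eucl n) 1, h (L ν) ∂(volume : Measure (Eucl n)).toSphere =
      ∫ ν : sphere (0 : Eucl n) 1, h ν ∂(volume : Measure (Eucl n)).toSphere := by
  have e : MeasurableEmbedding (sphereMap L) :=
    ((continuous_sphereMap L).isClosedEmbedding fun ν μ hνμ =>
      Subtype.ext (L.injective (congrArg Subtype.val hνμ))).measurableEmbedding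
  exact (measurePreserving_sphereMap L).integral_comp e (fun ν => h ν)

/-- The rotation by the angle `θ` in the plane spanned by `e_i` and `e_j`, as a linear map. -/
noncomputable def planeRotationLin (i j : Fin n) (θ : ℝ) : Eucl n →ₗ[ℝ] Eucl n where
  toFun x := x + ((Real.cos θ - 1) * x i - Real.sin θ * x j) • stdVec i +
    ((Real.cos θ - 1) * x j + Real.sin θ * x i) • stdVec j
  map_add' x y := by
    simp only [PiLp.add_apply]
    module
  map_smul' c x := by
    simp only [PiLp.smul_apply, smul_eq_mul, RingHom.id_apply]
    module

theorem planeRotationLin_apply (i j : Fin n) (θ : ℝ) (x : Eucl n) :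
    planeRotationLin i j θ x = x + ((Real.cos θ - 1) * x i - Real.sin θ * x j) • stdVec i +
    ((Real.cos θ - 1) * x j + Real.sin θ * x i) • stdVec j := rfl

theorem inner_stdVec (x : Eucl n) (i : Fin n) : inner ℝ x (stdVec i) = x i := by
  simp [stdVec, EuclideanSpace.inner_single_right]

theorem norm_planeRotationLin {i j : Fin n} (hij : i ≠ j) (θ : ℝ) (x : Eucl n) :
    ‖planeRotationLin i j θ x‖ = ‖x‖ := by
  have h1 : ∀ A B : ℝ, ‖x + A • stdVec i + B • stdVec j‖ ^ 2 =
      ‖x‖ ^ 2 + 2 * (A * x i + B * x j) + A ^ 2 + B ^ 2 := by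
    intro A B
    rw [← real_inner_self_eq_norm_sq, ← real_inner_self_eq_norm_sq]
    simp only [inner_add_left, inner_add_right, real_inner_smul_left, real_inner_smul_right,
      inner_stdVec, real_inner_comm x]
    simp [stdVec, hij, hij.symm]
    ring
  rw [← sq_eq_sq₀ (norm_nonneg _) (norm_nonneg _), planeRotationLin_apply, h1]
  linear_combination (x i ^ 2 + x j ^ 2) * Real.sin_sq_add_cos_sq θ

/-- The rotation by the angle `θ` in the plane spanned by `e_i` and `e_j`. -/
noncomputable def planeRotation {i j : Fin n} (hij : i ≠ j) (θ : ℝ) : Eucl n ≃ₗᵢ[ℝ] Eucl n :=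
  LinearIsometry.toLinearIsometryEquiv
    ⟨planeRotationLin i j θ, norm_planeRotationLin hij θ⟩ rfl

theorem planeRotation_apply {i j : Fin n} (hij : i ≠ j) (θ : ℝ) (x : Eucl n) :
    planeRotation hij θ x = x + ((Real.cos θ - 1) * x i - Real.sin θ * x j) • stdVec i +
    ((Real.cos θ - 1) * x j + Real.sin θ * x i) • stdVec j := rfl

theorem isOpen_exterior (R : ℝ) : IsOpen (closedBall (0 : Eucl n) R)ᶜ := isClosed_closedBall.isOpen_compl

theorem smul_sphere_mem {R r : ℝ} (hR : 0 ≤ R) (hr : R < r) (ν : sphere (0 : Eucl n) 1) :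
    r • (ν : Eucl n) ∈ (closedBall (0 : Eucl n) R)ᶜ := by
  have : 0 < r := hR.trans_lt hr
  simp [norm_smul, abs_of_pos this, hr]

/-- The integral over a sphere of the derivative of a function along an infinitesimal rotation
vanishes. -/
theorem integral_rotation_deriv {R r : ℝ} (hR : 0 ≤ R) (hr : R < r) {h : Eucl n → ℝ}
    (hh : ContDiffOn ℝ 1 h (closedBall 0 R)ᶜ) (i j : Fin n) :
    ∫ ν : sphere (0 : Eucl n) 1, fderiv ℝ h (r • (ν : Eucl n))
      ((r * (ν : Eucl n) i) • stdVec j - (r * (ν : Eucl n) j) • stdVec i)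
      ∂(volume : Measure (Eucl n)).toSphere = 0 := by
  by_cases hij : i = j
  · subst hij; simp
  have hmem : ∀ θ (ν : sphere (0 : Eucl n) 1),
      r • planeRotation hij θ ν ∈ (closedBall (0 : Eucl n) R)ᶜ := fun θ ν =>
    smul_sphere_mem hR hr (sphereMap (planeRotation hij θ) ν)
  have hdiff : ∀ x ∈ (closedBall (0 : Eucl n) R)ᶜ, HasFDerivAt h (fderiv ℝ h x) x := fun x hx =>
    ((hh.contDiffAt ((isOpen_exterior R).mem_nhds hx)).differentiableAt one_ne_zero).hasFDerivAt
  have hcont : ContinuousOn (fderiv ℝ h) (closedBall (0 : Eucl n) R)ᶜ :=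
    hh.continuousOn_fderiv_of_isOpen (isOpen_exterior R) le_rfl
  let V : ℝ → sphere (0 : Eucl n) 1 → Eucl n := fun θ ν =>
    r • ((-Real.sin θ * (ν : Eucl n) i - Real.cos θ * (ν : Eucl n) j) • stdVec i +
      (-Real.sin θ * (ν : Eucl n) j + Real.cos θ * (ν : Eucl n) i) • stdVec j)
  have key := hasDerivAt_sphere_integral (n := n) (s := Set.univ)
    (h := fun θ ν => h (r • planeRotation hij θ ν))
    (h' := fun θ ν => fderiv ℝ h (r • planeRotation hij θ ν) (V θ ν)) isOpen_univ
    (fun θ _ ν => by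
      have hrot : HasDerivAt (fun θ => r • planeRotation hij θ ν) (V θ ν) θ := by
        simp only [planeRotation_apply]
        refine HasDerivAt.const_smul r ?_
        have h1 : HasDerivAt (fun θ => (Real.cos θ - 1) * (ν : Eucl n) i -
            Real.sin θ * (ν : Eucl n) j) (-Real.sin θ * (ν : Eucl n) i -
            Real.cos θ * (ν : Eucl n) j) θ :=
          (((Real.hasDerivAt_cos θ).sub_const 1).mul_const _).sub
            ((Real.hasDerivAt_sin θ).mul_const _)
        have h2 : HasDerivAt (fun θ => (Real.cos θ - 1) * (ν : Eucl n) j +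
            Real.sin θ * (ν : Eucl n) i) (-Real.sin θ * (ν : Eucl n) j +
            Real.cos θ * (ν : Eucl n) i) θ :=
          (((Real.hasDerivAt_cos θ).sub_const 1).mul_const _).add
            ((Real.hasDerivAt_sin θ).mul_const _)
        exact ((h1.smul_const (stdVec i)).const_add _).add (h2.smul_const (stdVec j))
      exact (hdiff _ (hmem θ ν)).comp_hasDerivAt θ hrot)
    (fun θ _ => hh.continuousOn.comp_continuous
      (by fun_prop) (hmem θ))
    (by
      have c1 : Continuous fun p : ℝ × sphere (0 : Eucl n) 1 => r • planeRotation hij p.1 p.2 := by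
        simp only [planeRotation_apply]
        fun_prop
      have c2 : Continuous fun p : ℝ × sphere (0 : Eucl n) 1 => V p.1 p.2 := by
        simp only [V]
        fun_prop
      exact ((hcont.comp_continuous c1 fun p => hmem p.1 p.2).clm_apply c2).continuousOn)
    (Set.mem_univ (0 : ℝ))
  -- By rotation invariance the integral does not depend on `θ`, so its derivative at `θ = 0`, which
  -- is the integral in question, vanishes.
  have hconst : (fun θ => ∫ ν : sphere (0 : Eucl n) 1, h (r • planeRotation hij θ ν)
      ∂(volume : Measure (Eucl n)).toSphere) = fun _ => ∫ ν : sphere (0 : Eucl n) 1,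
        h (r • (ν : Eucl n)) ∂(volume : Measure (Eucl n)).toSphere := by
    ext θ
    exact integral_sphereMap (planeRotation hij θ) (fun x => h (r • x))
  rw [hconst] at key
  have := key.unique (hasDerivAt_const (0 : ℝ) _)
  rw [← this]
  refine integral_congr_ae (ae_of_all _ fun ν => ?_)
  have h0 : planeRotation hij 0 (ν : Eucl n) = ν := by simp [planeRotation_apply]
  simp only [h0, V, Real.sin_zero, Real.cos_zero]
  congr 1
  module

end SphereIntegral

/-! ### The flux through spheres -/

section Flux

variable {n : ℕ}

theorem sum_smul_stdVec (x : Eucl n) : ∑ i, x i • stdVec i = x := by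
  ext k
  simp [stdVec_apply]

/-- The divergence theorem on spheres in infinitesimal form, before multiplication by
`r ^ (n - 2)`. -/
theorem integral_divergence_sphere {R r : ℝ} (hR : 0 ≤ R) (hr : R < r) {F : Fin n → Eucl n → ℝ}
    (hF : ∀ k, ContDiffOn ℝ 1 (F k) (closedBall 0 R)ᶜ) :
    r * ∫ ν : sphere (0 : Eucl n) 1, ∑ k, pd k (F k) (r • (ν : Eucl n))
        ∂(volume : Measure (Eucl n)).toSphere =
      r * ∫ ν : sphere (0 : Eucl n) 1,
        ∑ k, fderiv ℝ (F k) (r • (ν : Eucl n)) ν * (ν : Eucl n) k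
        ∂(volume : Measure (Eucl n)).toSphere +
      ((n : ℝ) - 1) * ∫ ν : sphere (0 : Eucl n) 1, ∑ k, F k (r • (ν : Eucl n)) * (ν : Eucl n) k
        ∂(volume : Measure (Eucl n)).toSphere := by
  have hr0 : 0 < r := hR.trans_lt hr
  have hmem := smul_sphere_mem (n := n) hR hr
  have hdiff : ∀ k, ∀ x ∈ (closedBall (0 : Eucl n) R)ᶜ, DifferentiableAt ℝ (F k) x := fun k x hx =>
    ((hF k).contDiffAt ((isOpen_exterior R).mem_nhds hx)).differentiableAt one_ne_zero
  have hcd : ∀ k, Continuous fun ν : sphere (0 : Eucl n) 1 => fderiv ℝ (F k) (r • (ν : Eucl n)) :=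
    fun k => ((hF k).continuousOn_fderiv_of_isOpen (isOpen_exterior R) le_rfl).comp_continuous
      (by fun_prop) hmem
  have hc : ∀ k, Continuous fun ν : sphere (0 : Eucl n) 1 => F k (r • (ν : Eucl n)) :=
    fun k => (hF k).continuousOn.comp_continuous (by fun_prop) hmem
  -- The rotation field `x_i ∂_j - x_j ∂_i` is applied to `x_i F_j`. Summed over `i, j` with `|ν| =
  -- 1`, this produces the divergence, the radial derivative and the mean curvature term with factor
  -- `n - 1` (see `hpt`).
  have key : ∀ i j, ∫ ν : sphere (0 : Eucl n) 1, fderiv ℝ (fun x => x i * F j x) (r • (ν : Eucl n))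
      ((r * (ν : Eucl n) i) • stdVec j - (r * (ν : Eucl n) j) • stdVec i)
      ∂(volume : Measure (Eucl n)).toSphere = 0 := fun i j => by
    refine integral_rotation_deriv hR hr (ContDiffOn.mul ?_ (hF j)) i j
    exact (EuclideanSpace.proj (𝕜 := ℝ) i).contDiff.contDiffOn
  have hfd : ∀ i j (ν : sphere (0 : Eucl n) 1),
      fderiv ℝ (fun x => x i * F j x) (r • (ν : Eucl n))
      ((r * (ν : Eucl n) i) • stdVec j - (r * (ν : Eucl n) j) • stdVec i) =
      r ^ 2 * ((ν : Eucl n) i ^ 2 * pd j (F j) (r • (ν : Eucl n))) -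
      r ^ 2 * ((ν : Eucl n) j * ((ν : Eucl n) i * fderiv ℝ (F j) (r • (ν : Eucl n)) (stdVec i))) +
      r * ((if i = j then 1 else 0) * ((ν : Eucl n) i * F j (r • (ν : Eucl n)))) -
      r * ((ν : Eucl n) j * F j (r • (ν : Eucl n))) := by
    intro i j ν
    have h1 : HasFDerivAt (fun x : Eucl n => x i) (EuclideanSpace.proj (𝕜 := ℝ) i)
      (r • (ν : Eucl n)) := (EuclideanSpace.proj (𝕜 := ℝ) i).hasFDerivAt
    rw [(h1.fun_mul (hdiff j _ (hmem ν)).hasFDerivAt).fderiv]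
    simp [stdVec_apply, pd]
    split_ifs <;> ring
  have hsum : ∫ ν : sphere (0 : Eucl n) 1, ∑ i, ∑ j,
      fderiv ℝ (fun x => x i * F j x) (r • (ν : Eucl n))
      ((r * (ν : Eucl n) i) • stdVec j - (r * (ν : Eucl n) j) • stdVec i)
      ∂(volume : Measure (Eucl n)).toSphere = 0 := by
    have hint : ∀ i j, Integrable (fun ν : sphere (0 : Eucl n) 1 =>
        fderiv ℝ (fun x => x i * F j x) (r • (ν : Eucl n))
        ((r * (ν : Eucl n) i) • stdVec j - (r * (ν : Eucl n) j) • stdVec i))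
        (volume : Measure (Eucl n)).toSphere := fun i j => by
      apply integrable_sphere_of_continuous
      simp only [hfd, pd]
      have c0 : ∀ l : Fin n, Continuous fun ν : sphere (0 : Eucl n) 1 => (ν : Eucl n) l :=
        fun l => by fun_prop
      have c1 := hc j
      have c2 : ∀ v, Continuous fun ν : sphere (0 : Eucl n) 1 =>
          fderiv ℝ (F j) (r • (ν : Eucl n)) v := fun v => (hcd j).clm_apply continuous_const
      exact (((((c0 i).pow 2).mul (c2 _)).const_mul _).sub
        (((c0 j).mul ((c0 i).mul (c2 _))).const_mul _) |>.add
        ((((c0 i).mul c1).const_mul _).const_mul _)).sub (((c0 j).mul c1).const_mul _)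
    rw [integral_finsetSum _ fun i _ => integrable_finsetSum _ fun j _ => hint i j]
    refine Finset.sum_eq_zero fun i _ => ?_
    rw [integral_finsetSum _ fun j _ => hint i j]
    exact Finset.sum_eq_zero fun j _ => key i j
  have hpt : ∀ ν : sphere (0 : Eucl n) 1, ∑ i, ∑ j,
      fderiv ℝ (fun x => x i * F j x) (r • (ν : Eucl n))
      ((r * (ν : Eucl n) i) • stdVec j - (r * (ν : Eucl n) j) • stdVec i) =
      r * (r * ∑ k, pd k (F k) (r • (ν : Eucl n)) -
        r * ∑ k, fderiv ℝ (F k) (r • (ν : Eucl n)) ν * (ν : Eucl n) k -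
        ((n : ℝ) - 1) * ∑ k, F k (r • (ν : Eucl n)) * (ν : Eucl n) k) := by
    intro ν
    have hν : ∑ i, (ν : Eucl n) i ^ 2 = 1 := by
      have h := EuclideanSpace.real_norm_sq_eq (ν : Eucl n)
      rw [← h]
      simp
    have hlin : ∀ j, ∑ i, (ν : Eucl n) i * fderiv ℝ (F j) (r • (ν : Eucl n)) (stdVec i) =
        fderiv ℝ (F j) (r • (ν : Eucl n)) ν := fun j => by
      simpa using congrArg (fderiv ℝ (F j) (r • (ν : Eucl n))) (sum_smul_stdVec (ν : Eucl n))
    rw [Finset.sum_comm]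
    simp only [hfd, Finset.sum_sub_distrib, Finset.sum_add_distrib, ← Finset.mul_sum, ite_mul,
      one_mul, zero_mul, ← Finset.sum_mul, hν, hlin, Finset.sum_ite_eq', Finset.mem_univ, if_true,
      Finset.sum_const, Finset.card_univ, Fintype.card_fin, nsmul_eq_mul]
    simp only [mul_comm ((ν : Eucl n) _)]
    simp only [mul_assoc, ← Finset.mul_sum]
    ring
  simp only [hpt] at hsum
  have i1 : Integrable (fun ν : sphere (0 : Eucl n) 1 => ∑ k, pd k (F k) (r • (ν : Eucl n)))
      (volume : Measure (Eucl n)).toSphere := by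
    apply integrable_sphere_of_continuous
    simp only [pd]
    fun_prop
  have i2 : Integrable (fun ν : sphere (0 : Eucl n) 1 =>
      ∑ k, fderiv ℝ (F k) (r • (ν : Eucl n)) ν * (ν : Eucl n) k)
      (volume : Measure (Eucl n)).toSphere := by
    apply integrable_sphere_of_continuous
    fun_prop
  have i3 : Integrable (fun ν : sphere (0 : Eucl n) 1 => ∑ k, F k (r • (ν : Eucl n)) *
      (ν : Eucl n) k) (volume : Measure (Eucl n)).toSphere := by
    apply integrable_sphere_of_continuous
    exact continuous_finsetSum _ fun k _ => (hc k).mul (by fun_prop)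
  rw [integral_const_mul,
    integral_sub (f := fun ν : sphere (0 : Eucl n) 1 => r * _ - r * _)
      ((i1.const_mul _).sub (i2.const_mul _)) (i3.const_mul _),
    integral_sub (i1.const_mul _) (i2.const_mul _), integral_const_mul, integral_const_mul,
    integral_const_mul] at hsum
  have := (mul_eq_zero.1 hsum).resolve_left hr0.ne'
  linarith

/-- The derivative in `r` of the flux of a vector field through the sphere of radius `r`. -/
theorem hasDerivAt_flux (hn : 2 ≤ n) {R r : ℝ} (hR : 0 ≤ R) (hr : R < r) {F : Fin n → Eucl n → ℝ}
    (hF : ∀ k, ContDiffOn ℝ 1 (F k) (closedBall 0 R)ᶜ) :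
    HasDerivAt (sphereIntegral fun x ν => ∑ k, F k x * ν k)
      (sphereIntegral (fun x _ => ∑ k, pd k (F k) x) r) r := by
  have hmem := fun r (hr : R < r) => smul_sphere_mem (n := n) hR hr
  have hdiff : ∀ k, ∀ x ∈ (closedBall (0 : Eucl n) R)ᶜ, HasFDerivAt (F k) (fderiv ℝ (F k) x) x :=
    fun k x hx => (((hF k).contDiffAt ((isOpen_exterior R).mem_nhds hx)).differentiableAt
      one_ne_zero).hasFDerivAt
  have key := hasDerivAt_sphere_integral (n := n) (s := Set.Ioi R)
    (h := fun r ν => ∑ k, F k (r • (ν : Eucl n)) * (ν : Eucl n) k)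
    (h' := fun r ν => ∑ k, fderiv ℝ (F k) (r • (ν : Eucl n)) ν * (ν : Eucl n) k) isOpen_Ioi
    (fun t ht ν => by
      refine HasDerivAt.fun_sum fun k _ => HasDerivAt.mul_const ?_ _
      have h1 : HasDerivAt (fun t : ℝ => t • (ν : Eucl n)) (ν : Eucl n) t := by
        simpa using (hasDerivAt_id t).smul_const (ν : Eucl n)
      exact (hdiff k _ (hmem t ht ν)).comp_hasDerivAt t h1)
    (fun t ht => by
      have : ∀ k, Continuous fun ν : sphere (0 : Eucl n) 1 => F k (t • (ν : Eucl n)) :=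
        fun k => (hF k).continuousOn.comp_continuous (by fun_prop) (hmem t ht)
      exact continuous_finsetSum _ fun k _ => (this k).mul (by fun_prop))
    (by
      refine continuousOn_finsetSum _ fun k _ => ContinuousOn.mul ?_ (by fun_prop)
      refine ContinuousOn.clm_apply ?_ (by fun_prop)
      exact ((hF k).continuousOn_fderiv_of_isOpen (isOpen_exterior R) le_rfl).comp
        (by fun_prop) fun p hp => hmem p.1 hp.1 p.2) hr
  have h2 := (hasDerivAt_pow (n - 1) r).mul key
  refine h2.congr_deriv ?_
  -- With `n = m + 2` the truncated exponents `n - 1` and `n - 1 - 1` become `m + 1` and `m`.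
  obtain ⟨m, rfl⟩ : ∃ m, n = m + 2 := ⟨n - 2, by omega⟩
  have h3 := integral_divergence_sphere hR hr hF
  simp only [sphereIntegral, smul_eq_mul]
  have e1 : m + 2 - 1 = m + 1 := rfl
  have e2 : m + 1 - 1 = m := rfl
  rw [e1, e2, pow_succ]
  push_cast at h3 ⊢
  linear_combination -(r ^ m) * h3

end Flux

/-! ### Polar coordinates and limits of sphere integrals -/

section Polar

variable {n : ℕ}

/-- Integrability in polar coordinates. -/
theorem integrableOn_sphereIntegral (hn : 1 ≤ n) {R : ℝ} (hR : 0 ≤ R) {f : Eucl n → ℝ}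
    (hf : IntegrableOn f (closedBall 0 R)ᶜ) :
    IntegrableOn (sphereIntegral fun x _ => f x) (Set.Ioi R) := by
  have : Nonempty (Fin n) := ⟨⟨0, hn⟩⟩
  have : Nontrivial (Eucl n) := inferInstance
  -- Extension by zero makes the polar decomposition of the whole punctured space, followed by
  -- Fubini, applicable.
  set g : Eucl n → ℝ := (closedBall (0 : Eucl n) R)ᶜ.indicator f with hg
  have hgi : Integrable g := (integrable_indicator_iff (isOpen_exterior R).measurableSet).2 hf
  have h1 : Integrable (fun p : sphere (0 : Eucl n) 1 × Set.Ioi (0 : ℝ) =>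
      g ((p.2 : ℝ) • (p.1 : Eucl n)))
      ((volume : Measure (Eucl n)).toSphere.prod
        (.volumeIoiPow (Module.finrank ℝ (Eucl n) - 1))) := by
    rw [← (volume : Measure (Eucl n)).measurePreserving_homeomorphUnitSphereProd.integrable_comp_emb
      (Homeomorph.measurableEmbedding _)]
    have h2 : IntegrableOn g ({0}ᶜ : Set (Eucl n)) := hgi.integrableOn
    rw [integrableOn_iff_comap_subtypeVal (measurableSet_singleton _).compl] at h2
    refine h2.congr (ae_of_all _ fun x => ?_)
    simp only [Function.comp_apply, homeomorphUnitSphereProd_apply_snd_coe,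
      homeomorphUnitSphereProd_apply_fst_coe]
    rw [smul_inv_smul₀ (norm_ne_zero_iff.2 x.2)]
  have h3 := h1.integral_prod_right
  rw [Measure.volumeIoiPow, integrable_withDensity_iff_integrable_smul' (by fun_prop)
    (by simp)] at h3
  have h4 : IntegrableOn (fun r : ℝ => (ENNReal.ofReal (r ^ (n - 1))).toReal •
      ∫ ν : sphere (0 : Eucl n) 1, g (r • (ν : Eucl n))
        ∂(volume : Measure (Eucl n)).toSphere) (Set.Ioi 0) := by
    rw [integrableOn_iff_comap_subtypeVal measurableSet_Ioi]
    simpa [Function.comp_def] using h3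
  refine (h4.mono_set (Set.Ioi_subset_Ioi hR)).congr_fun (fun r hr => ?_) measurableSet_Ioi
  have hr0 : 0 < r := hR.trans_lt hr
  simp only [sphereIntegral]
  rw [ENNReal.toReal_ofReal (by positivity)]
  congr 1
  refine integral_congr_ae (ae_of_all _ fun ν => ?_)
  exact Set.indicator_of_mem (smul_sphere_mem hR hr ν) f

/-- The flux of a vector field with integrable divergence has a limit. -/
theorem tendsto_flux (hn : 2 ≤ n) {R : ℝ} (hR : 0 ≤ R) {F : Fin n → Eucl n → ℝ}
    (hF : ∀ k, ContDiffOn ℝ 1 (F k) (closedBall 0 R)ᶜ)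
    (hdiv : IntegrableOn (fun x => ∑ k, pd k (F k) x) (closedBall 0 R)ᶜ) :
    Tendsto (sphereIntegral fun x ν => ∑ k, F k x * ν k) atTop
      (𝓝 (limUnder atTop (sphereIntegral fun x ν => ∑ k, F k x * ν k))) :=
  tendsto_limUnder_of_hasDerivAt_of_integrableOn_Ioi (a := R)
    (fun _ hr => hasDerivAt_flux hn hR hr hF) (integrableOn_sphereIntegral (by omega) hR hdiv)

/-- Sphere integrals of functions decaying faster than `r ^ (1 - n)` tend to zero. -/
theorem tendsto_sphereIntegral_zero {F : Type*} [NormedAddCommGroup F] [NormedSpace ℝ F]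
    {f : Eucl n → Eucl n → F} {C R s : ℝ} (hs : s + ((n - 1 : ℕ) : ℝ) < 0)
    (hR : 0 ≤ R) (hf : ∀ x ∈ (closedBall (0 : Eucl n) R)ᶜ, ∀ ν ∈ sphere (0 : Eucl n) 1,
      ‖f x ν‖ ≤ C * ‖x‖ ^ s) :
    Tendsto (sphereIntegral f) atTop (𝓝 0) := by
  set m := (volume : Measure (Eucl n)).toSphere.real Set.univ
  have hlim : Tendsto (fun r : ℝ => C * m * r ^ (s + ((n - 1 : ℕ) : ℝ))) atTop (𝓝 0) := by
    have := (tendsto_rpow_neg_atTop (y := -(s + ((n - 1 : ℕ) : ℝ))) (by linarith)).const_mul (C * m)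
    simpa using this
  refine squeeze_zero_norm' ?_ hlim
  filter_upwards [eventually_gt_atTop R, eventually_gt_atTop 0] with r hr hr0
  rw [sphereIntegral, norm_smul, Real.norm_of_nonneg (by positivity)]
  have h1 : ‖∫ ν : sphere (0 : Eucl n) 1, f (r • (ν : Eucl n)) ν
      ∂(volume : Measure (Eucl n)).toSphere‖ ≤ C * r ^ s * m := by
    refine norm_integral_le_of_norm_le_const (ae_of_all _ fun ν => ?_)
    have := hf _ (smul_sphere_mem hR hr ν) ν ν.2
    simpa [norm_smul, abs_of_pos hr0] using this
  calc r ^ (n - 1) * _ ≤ r ^ (n - 1) * (C * r ^ s * m) := by gcongr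
    _ = C * m * r ^ (s + ((n - 1 : ℕ) : ℝ)) := by
      rw [Real.rpow_add hr0, Real.rpow_natCast]
      ring

end Polar

/-! ### Matrix calculus and the square root -/

section MatrixCalculus

-- A submultiplicative norm, so that decay rates of matrix products multiply.
attribute [local instance] Matrix.linftyOpNormedRing Matrix.linftyOpNormedAlgebra

variable {n : ℕ}

theorem abs_entry_le_norm (M : Matrix (Fin n) (Fin n) ℝ) (i j : Fin n) : |M i j| ≤ ‖M‖ := by
  rw [Matrix.linfty_opNorm_def]
  have h1 : ‖M i j‖₊ ≤ ∑ j, ‖M i j‖₊ :=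
    Finset.single_le_sum (f := fun j => ‖M i j‖₊) (fun _ _ => zero_le) (Finset.mem_univ j)
  have h2 := h1.trans (Finset.le_sup (f := fun i => ∑ j, ‖M i j‖₊) (Finset.mem_univ i))
  exact_mod_cast h2

/-- The entries of a matrix as continuous linear functions. -/
noncomputable def entryCLM (i j : Fin n) : Matrix (Fin n) (Fin n) ℝ →L[ℝ] ℝ :=
  LinearMap.toContinuousLinearMap (Matrix.entryLinearMap ℝ ℝ i j)

theorem isBigO_matrix_iff {α : Type*} {l : Filter α} {M : α → Matrix (Fin n) (Fin n) ℝ}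
    {φ : α → ℝ} : M =O[l] φ ↔ ∀ i j, (fun x => M x i j) =O[l] φ := by
  refine ⟨fun h i j => .trans (.of_bound 1 (Eventually.of_forall fun x => ?_)) h, fun h => ?_⟩
  · simpa using abs_entry_le_norm (M x) i j
  · have e : M = fun x => ∑ i, ∑ j, M x i j • Matrix.single i j (1 : ℝ) := by
      ext1 x
      conv_lhs => rw [Matrix.matrix_eq_sum_single (M x)]
      simp [Matrix.smul_single]
    have h2 : ∀ i j, (fun x => M x i j • Matrix.single i j (1 : ℝ)) =O[l] φ := fun i j => by
      have h1 : (fun _ => Matrix.single i j (1 : ℝ)) =O[l] fun _ => (1 : ℝ) :=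
        Asymptotics.isBigO_const_const _ one_ne_zero l
      simpa using (h i j).smul h1
    rw [e]
    exact Asymptotics.IsBigO.fun_sum fun i _ => Asymptotics.IsBigO.fun_sum fun j _ => h2 i j

theorem contDiffAt_matrix_iff {E : Type*} [NormedAddCommGroup E] [NormedSpace ℝ E]
    {M : E → Matrix (Fin n) (Fin n) ℝ} {m : ℕ∞ω} {x : E} :
    ContDiffAt ℝ m M x ↔ ∀ i j, ContDiffAt ℝ m (fun y => M y i j) x := by
  refine ⟨fun h i j => (entryCLM i j).contDiff.contDiffAt.comp x h, fun h => ?_⟩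
  have e : M = fun x => ∑ i, ∑ j, M x i j • Matrix.single i j (1 : ℝ) := by
    ext1 x
    conv_lhs => rw [Matrix.matrix_eq_sum_single (M x)]
    simp [Matrix.smul_single]
  rw [e]
  exact .sum fun i _ => .sum fun j _ => (h i j).smul contDiffAt_const

theorem pd_entry {M : Eucl n → Matrix (Fin n) (Fin n) ℝ} {x : Eucl n} (h : DifferentiableAt ℝ M x)
    (k i j : Fin n) : pd k (fun y => M y i j) x = fderiv ℝ M x (stdVec k) i j := by
  have := ((entryCLM i j).hasFDerivAt.comp x h.hasFDerivAt).fderiv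
  rw [pd]
  exact congrArg (fun f => f (stdVec k)) this

/-- Squaring of matrices has a smooth local inverse at the identity. -/
theorem exists_local_sqrt : ∃ s : Matrix (Fin n) (Fin n) ℝ → Matrix (Fin n) (Fin n) ℝ,
    (∀ᶠ P in 𝓝 (1 : Matrix (Fin n) (Fin n) ℝ), ContDiffAt ℝ 1 s P) ∧
      ∀ᶠ Y in 𝓝 (1 : Matrix (Fin n) (Fin n) ℝ), s (Y * Y) = Y := by
  let f : Matrix (Fin n) (Fin n) ℝ → Matrix (Fin n) (Fin n) ℝ := fun Y => Y * Y
  -- The derivative of squaring at the identity is multiplication by 2, so the inverse function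
  -- theorem applies.
  let f' : Matrix (Fin n) (Fin n) ℝ ≃L[ℝ] Matrix (Fin n) (Fin n) ℝ :=
    ContinuousLinearEquiv.smulLeft (Units.mk0 (2 : ℝ) two_ne_zero)
  have hf : ContDiffAt ℝ 1 f 1 := contDiffAt_id.mul contDiffAt_id
  have hf' : HasFDerivAt f (f' : Matrix (Fin n) (Fin n) ℝ →L[ℝ] Matrix (Fin n) (Fin n) ℝ) 1 := by
    have h := (hasFDerivAt_id (𝕜 := ℝ) (1 : Matrix (Fin n) (Fin n) ℝ)).mul'
      (hasFDerivAt_id (𝕜 := ℝ) (1 : Matrix (Fin n) (Fin n) ℝ))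
    refine h.congr_fderiv ?_
    ext1 Y
    change (1 : Matrix (Fin n) (Fin n) ℝ) * Y + Y * 1 = (2 : ℝ) • Y
    rw [one_mul, mul_one, two_smul]
  refine ⟨hf.localInverse hf' one_ne_zero, ?_, ?_⟩
  · have := hf.to_localInverse hf' one_ne_zero
    have h1 : f 1 = 1 := one_mul 1
    rw [h1] at this
    exact this.eventually (by simp)
  · exact (hf.hasStrictFDerivAt' hf' one_ne_zero).eventually_left_inverse

end MatrixCalculus

section SquareRoot

variable {n : ℕ}

/-- A positive semidefinite square root of `P` is at least as close to the identity as `P`. -/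
theorem abs_sub_one_le_of_mul_self_eq {H P : Matrix (Fin n) (Fin n) ℝ} (hH : H.PosSemidef)
    (hHP : H * H = P) (i j : Fin n) : |(H - 1) i j| ≤ ∑ l, |(P - 1) l j| := by
  -- For a column `v` of `H - 1`, the vector `(H + 1)v` is the corresponding column of `P - 1`, and
  -- `|(H + 1)v| ≥ |v|` because `H ≥ 0`.
  let v : Fin n → ℝ := fun l => (H - 1) l j
  have hv : H *ᵥ v + v = fun l => (P - 1) l j := by
    have : (H + 1) * (H - 1) = P - 1 := by rw [← hHP]; noncomm_ring
    ext l
    rw [← this, Matrix.mul_apply, Pi.add_apply, Matrix.mulVec, dotProduct]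
    simp only [Matrix.add_apply, add_mul, Finset.sum_add_distrib, Matrix.one_apply, ite_mul,
      one_mul, zero_mul, Finset.sum_ite_eq, Finset.mem_univ, if_true]
    rfl
  have h1 : v ⬝ᵥ v ≤ (H *ᵥ v + v) ⬝ᵥ (H *ᵥ v + v) := by
    have h2 : 0 ≤ v ⬝ᵥ (H *ᵥ v) := by simpa using hH.dotProduct_mulVec_nonneg v
    have h3 : 0 ≤ (H *ᵥ v) ⬝ᵥ (H *ᵥ v) := Finset.sum_nonneg fun l _ => mul_self_nonneg _
    rw [add_dotProduct, dotProduct_add, dotProduct_add, dotProduct_comm (H *ᵥ v) v]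
    linarith
  rw [hv] at h1
  have h4 : v i ^ 2 ≤ v ⬝ᵥ v := by
    rw [sq]
    exact Finset.single_le_sum (f := fun l => v l * v l) (fun l _ => mul_self_nonneg _)
      (Finset.mem_univ i)
  have h5 : (fun l => (P - 1) l j) ⬝ᵥ (fun l => (P - 1) l j) ≤ (∑ l, |(P - 1) l j|) ^ 2 := by
    rw [dotProduct]
    calc _ = ∑ l, |(P - 1) l j| ^ 2 := by simp [sq]
      _ ≤ _ := Finset.sum_sq_le_sq_sum_of_nonneg fun l _ => abs_nonneg _
  exact abs_le_of_sq_le_sq (h4.trans (h1.trans h5)) (Finset.sum_nonneg fun l _ => abs_nonneg _)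

-- A singular `G x` is allowed, its inverse being zero by convention; so `H² = G⁻¹` holds everywhere
-- and can be differentiated as an identity of functions.
open scoped MatrixOrder in
theorem frameMap_mul_self {G : Eucl n → Matrix (Fin n) (Fin n) ℝ} {x : Eucl n}
    (hG : (G x).PosSemidef) : frameMap G x * frameMap G x = (G x)⁻¹ :=
  CFC.sqrt_mul_sqrt_self _ hG.inv.nonneg

open scoped MatrixOrder in
theorem frameMap_posSemidef (G : Eucl n → Matrix (Fin n) (Fin n) ℝ) (x : Eucl n) :
    (frameMap G x).PosSemidef :=
  Matrix.nonneg_iff_posSemidef.1 (CFC.sqrt_nonneg _)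

end SquareRoot

/-! ### Asymptotics of the metric, its inverse and the frame -/

/-- A matrix valued function on `ℝⁿ` that is positive semidefinite, smooth outside a ball, and
asymptotic of order `τ` to the identity. -/
structure IsFlatAtInfinity {n : ℕ} (G : Eucl n → Matrix (Fin n) (Fin n) ℝ) (τ R : ℝ) : Prop where
  posSemidef : ∀ x, (G x).PosSemidef
  contDiffOn : ∀ i j, ContDiffOn ℝ ∞ (fun x => G x i j) (closedBall 0 R)ᶜ
  decay_zero : ∀ i j, (fun x => G x i j - (1 : Matrix (Fin n) (Fin n) ℝ) i j)
    =O[Bornology.cobounded (Eucl n)] fun x => ‖x‖ ^ (-τ)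
  decay_one : ∀ i j k, (fun x => pd k (fun y => G y i j) x)
    =O[Bornology.cobounded (Eucl n)] fun x => ‖x‖ ^ (-τ - 1)
  decay_two : ∀ i j k l, (fun x => pd k (pd l (fun y => G y i j)) x)
    =O[Bornology.cobounded (Eucl n)] fun x => ‖x‖ ^ (-τ - 2)

section Asymptotics

variable {n : ℕ}

theorem eventually_cobounded_iff {P : Eucl n → Prop} :
    (∀ᶠ x in Bornology.cobounded (Eucl n), P x) ↔
      ∃ R, 0 ≤ R ∧ ∀ x ∈ (closedBall (0 : Eucl n) R)ᶜ, P x := by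
  rw [(hasBasis_cobounded_compl_closedBall (0 : Eucl n)).eventually_iff]
  constructor
  · rintro ⟨R, -, h⟩
    exact ⟨max R 0, le_max_right _ _, fun x hx => h
      (Set.compl_subset_compl.2 (closedBall_subset_closedBall (le_max_left _ _)) hx)⟩
  · rintro ⟨R, -, h⟩
    exact ⟨R, trivial, fun x hx => h x hx⟩

/-- Exteriors of closed balls are open; identities valid near infinity can therefore be
differentiated there. -/
theorem eventually_cobounded_nhds {P : Eucl n → Prop}
    (h : ∀ᶠ x in Bornology.cobounded (Eucl n), P x) :
    ∀ᶠ x in Bornology.cobounded (Eucl n), ∀ᶠ y in 𝓝 x, P y := by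
  rw [eventually_cobounded_iff] at h ⊢
  obtain ⟨R, hR, h⟩ := h
  exact ⟨R, hR, fun x hx => Filter.mem_of_superset ((isOpen_exterior R).mem_nhds hx) h⟩

theorem rpow_mul_rpow_isBigO (a b c : ℝ) (h : a + b = c) :
    (fun x : Eucl n => ‖x‖ ^ a * ‖x‖ ^ b) =O[Bornology.cobounded (Eucl n)] fun x => ‖x‖ ^ c := by
  refine Asymptotics.IsBigO.of_bound 1 ?_
  rw [eventually_cobounded_iff]
  refine ⟨0, le_rfl, fun x hx => ?_⟩
  have hx0 : 0 < ‖x‖ := by simpa using hx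
  rw [← Real.rpow_add hx0, h, one_mul]

theorem rpow_isBigO_rpow {a b : ℝ} (h : a ≤ b) :
    (fun x : Eucl n => ‖x‖ ^ a) =O[Bornology.cobounded (Eucl n)] fun x => ‖x‖ ^ b := by
  refine Asymptotics.IsBigO.of_bound 1 ?_
  rw [eventually_cobounded_iff]
  refine ⟨1, zero_le_one, fun x hx => ?_⟩
  have hx0 : 1 < ‖x‖ := by simpa using hx
  rw [one_mul, Real.norm_of_nonneg (by positivity), Real.norm_of_nonneg (by positivity)]
  exact Real.rpow_le_rpow_of_exponent_le hx0.le h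

theorem rpow_tendsto_zero {a : ℝ} (h : a < 0) :
    Tendsto (fun x : Eucl n => ‖x‖ ^ a) (Bornology.cobounded (Eucl n)) (𝓝 0) := by
  have := (tendsto_rpow_neg_atTop (y := -a) (by linarith)).comp
    (tendsto_norm_cobounded_atTop (E := Eucl n))
  simpa [Function.comp_def] using this

/-- Contraction with a matrix that is close to the identity. -/
theorem isBigO_contraction {l : Filter (Eucl n)} {A : Fin n → Eucl n → ℝ} {b : Fin n → Eucl n → ℝ}
    {φ ψ : Eucl n → ℝ} (p : Fin n)
    (hA : ∀ i, (fun x => A i x - if i = p then 1 else 0) =O[l] φ) (hb : ∀ i, b i =O[l] ψ) :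
    (fun x => ∑ i, A i x * b i x - b p x) =O[l] fun x => φ x * ψ x := by
  have : (fun x => ∑ i, A i x * b i x - b p x) =
      fun x => ∑ i, (A i x - if i = p then 1 else 0) * b i x := by
    ext x
    simp [sub_mul, Finset.sum_sub_distrib]
  rw [this]
  exact Asymptotics.IsBigO.fun_sum fun i _ => (hA i).mul (hb i)

namespace IsFlatAtInfinity

attribute [local instance] Matrix.linftyOpNormedRing Matrix.linftyOpNormedAlgebra

variable {G : Eucl n → Matrix (Fin n) (Fin n) ℝ} {τ R : ℝ}

theorem symm (h : IsFlatAtInfinity G τ R) (x : Eucl n) (i j : Fin n) : G x i j = G x j i := by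
  simpa using congrFun (congrFun (h.posSemidef x).1 i) j |>.symm

theorem contDiffAt (h : IsFlatAtInfinity G τ R) :
    ∀ᶠ x in Bornology.cobounded (Eucl n), ContDiffAt ℝ ∞ G x := by
  rw [eventually_cobounded_iff]
  refine ⟨max R 0, le_max_right _ _, fun x hx => contDiffAt_matrix_iff.2 fun i j =>
    (h.contDiffOn i j).contDiffAt ((isOpen_exterior R).mem_nhds ?_)⟩
  simp only [Set.mem_compl_iff, mem_closedBall, dist_zero_right, not_le, max_lt_iff] at hx ⊢
  exact hx.1

theorem sub_one_isBigO (h : IsFlatAtInfinity G τ R) :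
    (fun x => G x - 1) =O[Bornology.cobounded (Eucl n)] fun x => ‖x‖ ^ (-τ) :=
  isBigO_matrix_iff.2 h.decay_zero

theorem tendsto_one (h : IsFlatAtInfinity G τ R) (hτ : 0 < τ) :
    Tendsto G (Bornology.cobounded (Eucl n)) (𝓝 1) := by
  have := h.sub_one_isBigO.trans_tendsto (rpow_tendsto_zero (by linarith))
  exact tendsto_sub_nhds_zero_iff.1 this

theorem eventually_isUnit (h : IsFlatAtInfinity G τ R) (hτ : 0 < τ) :
    ∀ᶠ x in Bornology.cobounded (Eucl n), IsUnit (G x) :=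
  (h.tendsto_one hτ).eventually (Units.isOpen.mem_nhds isUnit_one)

theorem inv_tendsto_one (h : IsFlatAtInfinity G τ R) (hτ : 0 < τ) :
    Tendsto (fun x => (G x)⁻¹) (Bornology.cobounded (Eucl n)) (𝓝 1) := by
  simp only [Matrix.nonsing_inv_eq_ringInverse]
  have h1 : ContinuousAt Ring.inverse (1 : Matrix (Fin n) (Fin n) ℝ) :=
    NormedRing.inverse_continuousAt (1 : (Matrix (Fin n) (Fin n) ℝ)ˣ)
  have := h1.tendsto.comp (h.tendsto_one hτ)
  rwa [Ring.inverse_one] at this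

theorem inv_mul (h : IsFlatAtInfinity G τ R) (hτ : 0 < τ) :
    ∀ᶠ x in Bornology.cobounded (Eucl n), (G x)⁻¹ * G x = 1 := by
  filter_upwards [h.eventually_isUnit hτ] with x hx
  exact Matrix.nonsing_inv_mul _ ((Matrix.isUnit_iff_isUnit_det _).1 hx)

theorem inv_sub_one_isBigO (h : IsFlatAtInfinity G τ R) (hτ : 0 < τ) :
    (fun x => (G x)⁻¹ - 1) =O[Bornology.cobounded (Eucl n)] fun x => ‖x‖ ^ (-τ) := by
  have h1 : (fun x => (G x)⁻¹) =O[Bornology.cobounded (Eucl n)] fun _ => (1 : ℝ) :=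
    (h.inv_tendsto_one hτ).isBigO_one ℝ
  have h2 : (fun x => -((G x)⁻¹ * (G x - 1))) =O[Bornology.cobounded (Eucl n)]
      fun x => ‖x‖ ^ (-τ) := by simpa using (h1.mul h.sub_one_isBigO).neg_left
  refine h2.congr' ?_ .rfl
  filter_upwards [h.inv_mul hτ] with x hx
  rw [mul_sub, hx, mul_one, neg_sub]

theorem contDiffAt_inv (h : IsFlatAtInfinity G τ R) (hτ : 0 < τ) :
    ∀ᶠ x in Bornology.cobounded (Eucl n), ContDiffAt ℝ ∞ (fun y => (G y)⁻¹) x := by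
  filter_upwards [h.eventually_isUnit hτ, h.contDiffAt] with x hx hG
  simp only [Matrix.nonsing_inv_eq_ringInverse]
  obtain ⟨u, hu⟩ := hx
  have h1 : ContDiffAt ℝ ∞ Ring.inverse (G x) := hu ▸ contDiffAt_ringInverse ℝ u
  exact h1.comp x hG

theorem fderiv_isBigO (h : IsFlatAtInfinity G τ R) (k : Fin n) :
    (fun x => fderiv ℝ G x (stdVec k)) =O[Bornology.cobounded (Eucl n)]
      fun x => ‖x‖ ^ (-τ - 1) := by
  rw [isBigO_matrix_iff]
  intro i j
  refine (h.decay_one i j k).congr' ?_ .rfl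
  filter_upwards [h.contDiffAt] with x hx
  exact pd_entry (hx.differentiableAt (by simp)) k i j

/-- `∂G⁻¹ = -G⁻¹ (∂G) G⁻¹`, and replacing either inverse by the identity costs a factor `O(r^{-τ})`.
-/
theorem fderiv_inv_add_isBigO (h : IsFlatAtInfinity G τ R) (hτ : 0 < τ) (k : Fin n) :
    (fun x => fderiv ℝ (fun y => (G y)⁻¹) x (stdVec k) + fderiv ℝ G x (stdVec k))
      =O[Bornology.cobounded (Eucl n)] fun x => ‖x‖ ^ (-2 * τ - 1) := by
  have h1 : (fun x => (G x)⁻¹) =O[Bornology.cobounded (Eucl n)] fun _ => (1 : ℝ) :=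
    (h.inv_tendsto_one hτ).isBigO_one ℝ
  have h2 : (fun x => -(((G x)⁻¹ - 1) * fderiv ℝ G x (stdVec k) * (G x)⁻¹) -
      fderiv ℝ G x (stdVec k) * ((G x)⁻¹ - 1)) =O[Bornology.cobounded (Eucl n)]
      fun x => ‖x‖ ^ (-2 * τ - 1) := by
    have e1 := ((h.inv_sub_one_isBigO hτ).mul (h.fderiv_isBigO k)).mul h1
    have e2 := (h.fderiv_isBigO k).mul (h.inv_sub_one_isBigO hτ)
    simp only [mul_one] at e1
    exact (e1.neg_left.trans (rpow_mul_rpow_isBigO _ _ _ (by ring))).sub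
      (e2.trans (rpow_mul_rpow_isBigO _ _ _ (by ring)))
  refine h2.congr' ?_ .rfl
  filter_upwards [eventually_cobounded_nhds (h.inv_mul hτ), h.contDiffAt, h.contDiffAt_inv hτ]
    with x hx hG hGi
  have d1 := (hG.differentiableAt (by simp)).hasFDerivAt
  have d2 := (hGi.differentiableAt (by simp)).hasFDerivAt
  have d3 : HasFDerivAt (fun y => (G y)⁻¹ * G y) (0 : Eucl n →L[ℝ] Matrix (Fin n) (Fin n) ℝ) x :=
    (hasFDerivAt_const (1 : Matrix (Fin n) (Fin n) ℝ) x).congr_of_eventuallyEq hx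
  have d4 := congrArg (fun f => f (stdVec k)) ((d2.mul' d1).unique d3)
  have d5 : (G x)⁻¹ * fderiv ℝ G x (stdVec k) +
      fderiv ℝ (fun y => (G y)⁻¹) x (stdVec k) * G x = 0 := d4
  have hx1 : G x * (G x)⁻¹ = 1 := mul_eq_one_comm.1 hx.self_of_nhds
  have d6 : fderiv ℝ (fun y => (G y)⁻¹) x (stdVec k) =
      -((G x)⁻¹ * fderiv ℝ G x (stdVec k) * (G x)⁻¹) := by
    have := congrArg (· * (G x)⁻¹) d5
    simp only [add_mul, zero_mul, mul_assoc, hx1, mul_one] at this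
    rw [mul_assoc]
    exact eq_neg_of_add_eq_zero_right this
  rw [d6]
  noncomm_ring

theorem frameMap_sub_one_isBigO (h : IsFlatAtInfinity G τ R) (hτ : 0 < τ) :
    (fun x => frameMap G x - 1) =O[Bornology.cobounded (Eucl n)] fun x => ‖x‖ ^ (-τ) := by
  rw [isBigO_matrix_iff]
  intro i j
  have h1 : (fun x => ∑ l, |((G x)⁻¹ - 1) l j|) =O[Bornology.cobounded (Eucl n)]
      fun x => ‖x‖ ^ (-τ) :=
    Asymptotics.IsBigO.fun_sum fun l _ => (isBigO_matrix_iff.1 (h.inv_sub_one_isBigO hτ) l j).abs_left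
  refine .trans (.of_bound 1 (Eventually.of_forall fun x => ?_)) h1
  rw [one_mul, Real.norm_eq_abs, Real.norm_of_nonneg (Finset.sum_nonneg fun l _ => abs_nonneg _)]
  exact abs_sub_one_le_of_mul_self_eq (frameMap_posSemidef G x)
    (frameMap_mul_self (h.posSemidef x)) i j

theorem frameMap_tendsto_one (h : IsFlatAtInfinity G τ R) (hτ : 0 < τ) :
    Tendsto (frameMap G) (Bornology.cobounded (Eucl n)) (𝓝 1) :=
  tendsto_sub_nhds_zero_iff.1
    ((h.frameMap_sub_one_isBigO hτ).trans_tendsto (rpow_tendsto_zero (by linarith)))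

/-- As `H` tends to the identity, near infinity it agrees with the smooth local square root applied
to `G⁻¹`. -/
theorem contDiffAt_frameMap (h : IsFlatAtInfinity G τ R) (hτ : 0 < τ) :
    ∀ᶠ x in Bornology.cobounded (Eucl n), ContDiffAt ℝ 1 (frameMap G) x := by
  obtain ⟨s, hs1, hs2⟩ := exists_local_sqrt (n := n)
  filter_upwards [(h.inv_tendsto_one hτ).eventually hs1, h.contDiffAt_inv hτ,
    eventually_cobounded_nhds ((h.frameMap_tendsto_one hτ).eventually hs2)] with x h1 h2 h3
  refine (h1.comp x (h2.of_le (by simp))).congr_of_eventuallyEq ?_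
  filter_upwards [h3] with y hy
  rw [frameMap_mul_self (h.posSemidef y)] at hy
  exact hy.symm

/-- Differentiating `H² = G⁻¹` gives `H ∂H + ∂H H = ∂G⁻¹`, whose leading part is `2 ∂H = -∂G`. -/
theorem fderiv_frameMap_add_isBigO (h : IsFlatAtInfinity G τ R) (hτ : 0 < τ) (k : Fin n) :
    (fun x => fderiv ℝ (frameMap G) x (stdVec k) + (1 / 2 : ℝ) • fderiv ℝ G x (stdVec k))
      =O[Bornology.cobounded (Eucl n)] fun x => ‖x‖ ^ (-2 * τ - 1) := by
  have key : ∀ᶠ x in Bornology.cobounded (Eucl n),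
      frameMap G x * fderiv ℝ (frameMap G) x (stdVec k) +
        fderiv ℝ (frameMap G) x (stdVec k) * frameMap G x =
        fderiv ℝ (fun y => (G y)⁻¹) x (stdVec k) := by
    filter_upwards [h.contDiffAt_frameMap hτ] with x hx
    have d1 := (hx.differentiableAt one_ne_zero).hasFDerivAt
    have d2 := (d1.mul' d1).fderiv
    have e : (frameMap G * frameMap G) = fun y => (G y)⁻¹ := by
      ext1 y
      exact frameMap_mul_self (h.posSemidef y)
    rw [e] at d2
    exact (congrArg (fun f => f (stdVec k)) d2).symm
  have hsplit : ∀ᶠ x in Bornology.cobounded (Eucl n),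
      fderiv ℝ (frameMap G) x (stdVec k) = (1 / 2 : ℝ) • (fderiv ℝ (fun y => (G y)⁻¹) x (stdVec k) -
        (frameMap G x - 1) * fderiv ℝ (frameMap G) x (stdVec k) -
        fderiv ℝ (frameMap G) x (stdVec k) * (frameMap G x - 1)) := by
    filter_upwards [key] with x hx
    rw [← hx, sub_mul, mul_sub, one_mul, mul_one]
    module
  -- A priori decay of `∂H`: once `‖H - 1‖ ≤ 1/2`, the terms of `hsplit` containing `∂H` are
  -- absorbed into the left side, leaving `‖∂H‖ ≤ ‖∂G⁻¹‖`.
  have hO : (fun x => fderiv ℝ (frameMap G) x (stdVec k)) =O[Bornology.cobounded (Eucl n)]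
      fun x => ‖x‖ ^ (-τ - 1) := by
    have h1 : (fun x => fderiv ℝ (fun y => (G y)⁻¹) x (stdVec k))
        =O[Bornology.cobounded (Eucl n)] fun x => ‖x‖ ^ (-τ - 1) := by
      have := ((h.fderiv_inv_add_isBigO hτ k).trans
        (rpow_isBigO_rpow (by linarith : -2 * τ - 1 ≤ -τ - 1))).sub (h.fderiv_isBigO k)
      simpa using this
    refine .trans (.of_bound 1 ?_) h1
    have hsmall : ∀ᶠ x in Bornology.cobounded (Eucl n), ‖frameMap G x - 1‖ ≤ 1 / 2 := by
      have := ((h.frameMap_sub_one_isBigO hτ).trans_tendsto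
        (rpow_tendsto_zero (by linarith))).norm
      rw [norm_zero] at this
      exact this.eventually_le_const (by norm_num)
    filter_upwards [hsplit, hsmall] with x hx hs
    set D := fderiv ℝ (frameMap G) x (stdVec k)
    set Q := fderiv ℝ (fun y => (G y)⁻¹) x (stdVec k)
    have e1 : ‖D‖ ≤ (1 / 2) * (‖Q‖ + ‖frameMap G x - 1‖ * ‖D‖ + ‖D‖ * ‖frameMap G x - 1‖) := by
      conv_lhs => rw [hx]
      rw [norm_smul, Real.norm_of_nonneg (by norm_num)]
      gcongr
      refine (norm_sub_le _ _).trans (add_le_add ((norm_sub_le _ _).trans ?_) (norm_mul_le _ _))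
      gcongr
      exact norm_mul_le _ _
    have e2 : ‖frameMap G x - 1‖ * ‖D‖ ≤ 1 / 2 * ‖D‖ := by gcongr
    rw [one_mul]
    nlinarith
  have hp : (fun x => (1 / 2 : ℝ) • ((fderiv ℝ (fun y => (G y)⁻¹) x (stdVec k) +
      fderiv ℝ G x (stdVec k)) - (frameMap G x - 1) * fderiv ℝ (frameMap G) x (stdVec k) -
        fderiv ℝ (frameMap G) x (stdVec k) * (frameMap G x - 1)))
      =O[Bornology.cobounded (Eucl n)] fun x => ‖x‖ ^ (-2 * τ - 1) := by
    have e1 := ((h.frameMap_sub_one_isBigO hτ).mul hO).trans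
      (rpow_mul_rpow_isBigO _ _ (-2 * τ - 1) (by ring))
    have e2 := (hO.mul (h.frameMap_sub_one_isBigO hτ)).trans
      (rpow_mul_rpow_isBigO _ _ (-2 * τ - 1) (by ring))
    exact (((h.fderiv_inv_add_isBigO hτ k).sub e1).sub e2).const_smul_left (1 / 2 : ℝ)
  refine hp.congr' ?_ .rfl
  filter_upwards [hsplit] with x hx
  conv_rhs => rw [hx]
  module

end IsFlatAtInfinity

end Asymptotics

/-! ### Asymptotics of the connection and the curvature -/

section PartialDerivatives

variable {n : ℕ} {f g : Eucl n → ℝ} {x : Eucl n}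

theorem pd_fun_mul (hf : DifferentiableAt ℝ f x) (hg : DifferentiableAt ℝ g x) (k : Fin n) :
    pd k (fun y => f y * g y) x = pd k f x * g x + f x * pd k g x := by
  rw [pd, fderiv_fun_mul hf hg]
  simp [pd]
  ring

theorem pd_fun_add (hf : DifferentiableAt ℝ f x) (hg : DifferentiableAt ℝ g x) (k : Fin n) :
    pd k (fun y => f y + g y) x = pd k f x + pd k g x := by
  rw [pd, fderiv_fun_add hf hg]
  rfl

theorem pd_fun_sub (hf : DifferentiableAt ℝ f x) (hg : DifferentiableAt ℝ g x) (k : Fin n) :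
    pd k (fun y => f y - g y) x = pd k f x - pd k g x := by
  rw [pd, fderiv_fun_sub hf hg]
  rfl

theorem pd_const_mul (hf : DifferentiableAt ℝ f x) (c : ℝ) (k : Fin n) :
    pd k (fun y => c * f y) x = c * pd k f x := by
  rw [pd, fderiv_const_mul hf]
  rfl

theorem pd_fun_sum {ι : Type*} {s : Finset ι} {F : ι → Eucl n → ℝ}
    (hF : ∀ i ∈ s, DifferentiableAt ℝ (F i) x) (k : Fin n) :
    pd k (fun y => ∑ i ∈ s, F i y) x = ∑ i ∈ s, pd k (F i) x := by
  rw [pd, fderiv_fun_sum hF]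
  simp [pd]

theorem contDiffAt_pd (hf : ContDiffAt ℝ ∞ f x) (k : Fin n) : ContDiffAt ℝ ∞ (pd k f) x :=
  (hf.fderiv_right (m := ∞) (by simp)).clm_apply contDiffAt_const

end PartialDerivatives

section Connection

variable {n : ℕ} (G : Eucl n → Matrix (Fin n) (Fin n) ℝ)

/-- The Christoffel symbols of the first kind `Γ_{l,ij}`. -/
noncomputable def christoffelFirst (i j l : Fin n) (x : Eucl n) : ℝ :=
  (1 / 2) * (pd i (fun y => G y j l) x + pd j (fun y => G y i l) x - pd l (fun y => G y i j) x)

/-- The second order terms of the derivatives `∂_m Γ_{l,ij}`. -/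
noncomputable def christoffelFirstDeriv (m i j l : Fin n) (x : Eucl n) : ℝ :=
  (1 / 2) * (pd m (pd i (fun y => G y j l)) x + pd m (pd j (fun y => G y i l)) x -
    pd m (pd l (fun y => G y i j)) x)

theorem christoffel_eq (x : Eucl n) (k i j : Fin n) :
    christoffel G x k i j = ∑ l, (G x)⁻¹ k l * christoffelFirst G i j l x := by
  rw [christoffel, Finset.mul_sum]
  refine Finset.sum_congr rfl fun l _ => ?_
  rw [christoffelFirst]
  ring

attribute [local instance] Matrix.linftyOpNormedRing Matrix.linftyOpNormedAlgebra

variable {G} {τ R : ℝ}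

namespace IsFlatAtInfinity

theorem contDiffAt_entry (h : IsFlatAtInfinity G τ R) :
    ∀ᶠ x in Bornology.cobounded (Eucl n), ∀ i j, ContDiffAt ℝ ∞ (fun y => G y i j) x := by
  filter_upwards [h.contDiffAt] with x hx
  exact contDiffAt_matrix_iff.1 hx

theorem contDiffAt_inv_entry (h : IsFlatAtInfinity G τ R) (hτ : 0 < τ) :
    ∀ᶠ x in Bornology.cobounded (Eucl n), ∀ i j, ContDiffAt ℝ ∞ (fun y => (G y)⁻¹ i j) x := by
  filter_upwards [h.contDiffAt_inv hτ] with x hx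
  exact contDiffAt_matrix_iff.1 hx

theorem contDiffAt_frameMap_entry (h : IsFlatAtInfinity G τ R) (hτ : 0 < τ) :
    ∀ᶠ x in Bornology.cobounded (Eucl n), ∀ i j, ContDiffAt ℝ 1 (fun y => frameMap G y i j) x := by
  filter_upwards [h.contDiffAt_frameMap hτ] with x hx
  exact contDiffAt_matrix_iff.1 hx

theorem inv_entry_isBigO (h : IsFlatAtInfinity G τ R) (hτ : 0 < τ) (i j : Fin n) :
    (fun x => (G x)⁻¹ i j - if j = i then 1 else 0) =O[Bornology.cobounded (Eucl n)]
      fun x => ‖x‖ ^ (-τ) := by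
  simpa [Matrix.one_apply, eq_comm] using isBigO_matrix_iff.1 (h.inv_sub_one_isBigO hτ) i j

theorem frameMap_entry_isBigO (h : IsFlatAtInfinity G τ R) (hτ : 0 < τ) (i j : Fin n) :
    (fun x => frameMap G x i j - if i = j then 1 else 0) =O[Bornology.cobounded (Eucl n)]
      fun x => ‖x‖ ^ (-τ) := by
  simpa [Matrix.one_apply] using isBigO_matrix_iff.1 (h.frameMap_sub_one_isBigO hτ) i j

theorem pd_inv_entry_isBigO (h : IsFlatAtInfinity G τ R) (hτ : 0 < τ) (k i j : Fin n) :
    (fun x => pd k (fun y => (G y)⁻¹ i j) x) =O[Bornology.cobounded (Eucl n)]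
      fun x => ‖x‖ ^ (-τ - 1) := by
  have h1 := isBigO_matrix_iff.1 (h.fderiv_inv_add_isBigO hτ k) i j
  have h2 := (h1.trans (rpow_isBigO_rpow (by linarith : -2 * τ - 1 ≤ -τ - 1))).sub
    (isBigO_matrix_iff.1 (h.fderiv_isBigO k) i j)
  refine h2.congr' ?_ .rfl
  filter_upwards [h.contDiffAt_inv hτ] with x hx
  rw [pd_entry (hx.differentiableAt (by simp))]
  simp

theorem pd_frameMap_entry_isBigO (h : IsFlatAtInfinity G τ R) (hτ : 0 < τ) (k i j : Fin n) :
    (fun x => pd k (fun y => frameMap G y i j) x + (1 / 2) * pd k (fun y => G y i j) x)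
      =O[Bornology.cobounded (Eucl n)] fun x => ‖x‖ ^ (-2 * τ - 1) := by
  refine (isBigO_matrix_iff.1 (h.fderiv_frameMap_add_isBigO hτ k) i j).congr' ?_ .rfl
  filter_upwards [h.contDiffAt_frameMap hτ, h.contDiffAt] with x hx hG
  rw [pd_entry (hx.differentiableAt one_ne_zero), pd_entry (hG.differentiableAt (by simp))]
  simp

theorem christoffelFirst_isBigO (h : IsFlatAtInfinity G τ R) (i j l : Fin n) :
    christoffelFirst G i j l =O[Bornology.cobounded (Eucl n)] fun x => ‖x‖ ^ (-τ - 1) :=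
  (((h.decay_one j l i).add (h.decay_one i l j)).sub (h.decay_one i j l)).const_mul_left _

theorem christoffelFirstDeriv_isBigO (h : IsFlatAtInfinity G τ R) (m i j l : Fin n) :
    christoffelFirstDeriv G m i j l =O[Bornology.cobounded (Eucl n)] fun x => ‖x‖ ^ (-τ - 2) :=
  (((h.decay_two j l m i).add (h.decay_two i l m j)).sub (h.decay_two i j m l)).const_mul_left _

theorem christoffel_sub_isBigO (h : IsFlatAtInfinity G τ R) (hτ : 0 < τ) (k i j : Fin n) :
    (fun x => christoffel G x k i j - christoffelFirst G i j k x)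
      =O[Bornology.cobounded (Eucl n)] fun x => ‖x‖ ^ (-2 * τ - 1) := by
  simp only [christoffel_eq]
  exact (isBigO_contraction (A := fun l x => (G x)⁻¹ k l) k (h.inv_entry_isBigO hτ k)
    (h.christoffelFirst_isBigO i j)).trans (rpow_mul_rpow_isBigO _ _ _ (by ring))

theorem christoffel_isBigO (h : IsFlatAtInfinity G τ R) (hτ : 0 < τ) (k i j : Fin n) :
    (fun x => christoffel G x k i j) =O[Bornology.cobounded (Eucl n)] fun x => ‖x‖ ^ (-τ - 1) := by
  simpa using ((h.christoffel_sub_isBigO hτ k i j).trans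
    (rpow_isBigO_rpow (by linarith : -2 * τ - 1 ≤ -τ - 1))).add (h.christoffelFirst_isBigO i j k)

theorem nablaFrame_sub_isBigO (h : IsFlatAtInfinity G τ R) (hτ : 0 < τ) (i j l : Fin n) :
    (fun x => nablaFrame G x i j l - (christoffelFirst G i j l x -
      (1 / 2) * pd i (fun y => G y l j) x))
      =O[Bornology.cobounded (Eucl n)] fun x => ‖x‖ ^ (-2 * τ - 1) := by
  have h1 := (isBigO_contraction (A := fun m x => frameMap G x m j)
    (b := fun m x => christoffel G x l i m) j (fun m => h.frameMap_entry_isBigO hτ m j)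
    (fun m => h.christoffel_isBigO hτ l i m)).trans
    (rpow_mul_rpow_isBigO _ _ (-2 * τ - 1) (by ring))
  refine ((h.pd_frameMap_entry_isBigO hτ i l j).add
    (h1.add (h.christoffel_sub_isBigO hτ l i j))).congr_left fun x => ?_
  simp only [nablaFrame, mul_comm (frameMap G x _ _)]
  ring

theorem nablaFrame_isBigO (h : IsFlatAtInfinity G τ R) (hτ : 0 < τ) (i j l : Fin n) :
    (fun x => nablaFrame G x i j l) =O[Bornology.cobounded (Eucl n)] fun x => ‖x‖ ^ (-τ - 1) := by
  simpa using ((h.nablaFrame_sub_isBigO hτ i j l).trans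
    (rpow_isBigO_rpow (by linarith : -2 * τ - 1 ≤ -τ - 1))).add
    ((h.christoffelFirst_isBigO i j l).sub ((h.decay_one l j i).const_mul_left (1 / 2)))

/-- The linearization of the connection form at infinity. -/
theorem connCoeff_sub_isBigO (h : IsFlatAtInfinity G τ R) (hτ : 0 < τ) (i j k : Fin n) :
    (fun x => connCoeff G x i j k -
      (1 / 2) * (pd j (fun y => G y i k) x - pd k (fun y => G y i j) x))
      =O[Bornology.cobounded (Eucl n)] fun x => ‖x‖ ^ (-2 * τ - 1) := by
  have hG1 : ∀ l p, (fun x => G x l p) =O[Bornology.cobounded (Eucl n)] fun _ => (1 : ℝ) := by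
    intro l p
    have h1 : (fun x : Eucl n => ‖x‖ ^ (-τ)) =O[Bornology.cobounded (Eucl n)] fun _ => (1 : ℝ) := by
      simpa using rpow_isBigO_rpow (n := n) (by linarith : -τ ≤ 0)
    simpa using ((h.decay_zero l p).trans h1).add
      (Asymptotics.isBigO_const_const ((1 : Matrix (Fin n) (Fin n) ℝ) l p) one_ne_zero _)
  -- Pairing with `H e_k` under `g` is, up to `O(r^{-τ})`, extraction of the `k`-th coordinate.
  have hA : ∀ l, (fun x => ∑ p, frameMap G x p k * G x l p - if l = k then 1 else 0)
      =O[Bornology.cobounded (Eucl n)] fun x => ‖x‖ ^ (-τ) := by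
    intro l
    have h1 := isBigO_contraction (A := fun p x => frameMap G x p k) (b := fun p x => G x l p) k
      (fun p => h.frameMap_entry_isBigO hτ p k) (hG1 l)
    simp only [mul_one] at h1
    refine (h1.add (h.decay_zero l k)).congr_left fun x => ?_
    simp [Matrix.one_apply]
  have h2 := (isBigO_contraction (b := fun l x => nablaFrame G x i j l) k hA
    (h.nablaFrame_isBigO hτ i j)).trans (rpow_mul_rpow_isBigO _ _ (-2 * τ - 1) (by ring))
  refine (h2.add (h.nablaFrame_sub_isBigO hτ i j k)).congr_left fun x => ?_
  have hsymm : (fun y => G y k j) = fun y => G y j k := funext fun y => h.symm y k j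
  have e : connCoeff G x i j k =
      ∑ l, (∑ p, frameMap G x p k * G x l p) * nablaFrame G x i j l := by
    rw [connCoeff]
    refine Finset.sum_congr rfl fun l _ => ?_
    rw [Finset.sum_mul]
    exact Finset.sum_congr rfl fun p _ => by ring
  rw [e, christoffelFirst, hsymm]
  ring

/-- A derivative falling on `g⁻¹` gives a product of two first-order terms; one falling on
`Γ_{l,ij}` gives the stated linear term after `g⁻¹` is replaced by the identity. -/
theorem pd_christoffel_sub_isBigO (h : IsFlatAtInfinity G τ R) (hτ : 0 < τ) (m k i j : Fin n) :
    (fun x => pd m (fun y => christoffel G y k i j) x - christoffelFirstDeriv G m i j k x)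
      =O[Bornology.cobounded (Eucl n)] fun x => ‖x‖ ^ (-2 * τ - 2) := by
  have h1 : (fun x => ∑ l, pd m (fun y => (G y)⁻¹ k l) x * christoffelFirst G i j l x)
      =O[Bornology.cobounded (Eucl n)] fun x => ‖x‖ ^ (-2 * τ - 2) :=
    Asymptotics.IsBigO.fun_sum fun l _ =>
      ((h.pd_inv_entry_isBigO hτ m k l).mul (h.christoffelFirst_isBigO i j l)).trans
        (rpow_mul_rpow_isBigO _ _ _ (by ring))
  have h2 := (isBigO_contraction (A := fun l x => (G x)⁻¹ k l) k (h.inv_entry_isBigO hτ k)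
    (h.christoffelFirstDeriv_isBigO m i j)).trans
    (rpow_mul_rpow_isBigO _ _ (-2 * τ - 2) (by ring))
  refine (h1.add h2).congr' ?_ .rfl
  filter_upwards [h.contDiffAt_entry, h.contDiffAt_inv_entry hτ] with x hG hGi
  have d1 : ∀ l i j, DifferentiableAt ℝ (pd l fun y => G y i j) x := fun l i j =>
    (contDiffAt_pd (hG i j) l).differentiableAt (by simp)
  have d2 : ∀ i j l, HasFDerivAt (christoffelFirst G i j l)
      (fderiv ℝ (christoffelFirst G i j l) x) x := fun i j l =>
    ((((d1 i j l).fun_add (d1 j i l)).fun_sub (d1 l i j)).const_mul (1 / 2)).hasFDerivAt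
  have d3 : ∀ l, pd m (christoffelFirst G i j l) x = christoffelFirstDeriv G m i j l x := by
    intro l
    have : christoffelFirst G i j l = fun y => (1 / 2 : ℝ) * ((pd i (fun y => G y j l) y +
      pd j (fun y => G y i l) y) - pd l (fun y => G y i j) y) := rfl
    rw [this, pd_const_mul (((d1 i j l).fun_add (d1 j i l)).fun_sub (d1 l i j)),
      pd_fun_sub ((d1 i j l).fun_add (d1 j i l)) (d1 l i j), pd_fun_add (d1 i j l) (d1 j i l)]
    rfl
  have d4 : ∀ l, DifferentiableAt ℝ (fun y => (G y)⁻¹ k l) x := fun l =>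
    (hGi k l).differentiableAt (by simp)
  simp only [christoffel_eq]
  rw [pd_fun_sum fun l _ => (d4 l).fun_mul (d2 i j l).differentiableAt]
  simp only [fun l => pd_fun_mul (d4 l) (d2 i j l).differentiableAt m, d3, Finset.sum_add_distrib]
  ring

theorem ricci_sub_isBigO (h : IsFlatAtInfinity G τ R) (hτ : 0 < τ) (i j : Fin n) :
    (fun x => ricci G x i j - ∑ k, (christoffelFirstDeriv G k i j k x -
      christoffelFirstDeriv G j i k k x))
      =O[Bornology.cobounded (Eucl n)] fun x => ‖x‖ ^ (-2 * τ - 2) := by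
  have h1 : (fun x => ∑ k, ((pd k (fun y => christoffel G y k i j) x -
      christoffelFirstDeriv G k i j k x) - (pd j (fun y => christoffel G y k i k) x -
      christoffelFirstDeriv G j i k k x)))
      =O[Bornology.cobounded (Eucl n)] fun x => ‖x‖ ^ (-2 * τ - 2) :=
    Asymptotics.IsBigO.fun_sum fun k _ =>
      (h.pd_christoffel_sub_isBigO hτ k k i j).sub (h.pd_christoffel_sub_isBigO hτ j k i k)
  have hq : ∀ a b c a' b' c', (fun x => christoffel G x a b c * christoffel G x a' b' c')
      =O[Bornology.cobounded (Eucl n)] fun x => ‖x‖ ^ (-2 * τ - 2) := fun a b c a' b' c' =>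
    ((h.christoffel_isBigO hτ a b c).mul (h.christoffel_isBigO hτ a' b' c')).trans
      (rpow_mul_rpow_isBigO _ _ _ (by ring))
  have h2 : (fun x => ∑ k, ∑ l, (christoffel G x k k l * christoffel G x l i j -
      christoffel G x k j l * christoffel G x l i k))
      =O[Bornology.cobounded (Eucl n)] fun x => ‖x‖ ^ (-2 * τ - 2) :=
    Asymptotics.IsBigO.fun_sum fun k _ => Asymptotics.IsBigO.fun_sum fun l _ =>
      (hq _ _ _ _ _ _).sub (hq _ _ _ _ _ _)
  refine (h1.add h2).congr_left fun x => ?_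
  simp only [ricci, Finset.sum_sub_distrib]
  ring

theorem ricci_isBigO (h : IsFlatAtInfinity G τ R) (hτ : 0 < τ) (i j : Fin n) :
    (fun x => ricci G x i j) =O[Bornology.cobounded (Eucl n)] fun x => ‖x‖ ^ (-τ - 2) := by
  have h1 : (fun x => ∑ k, (christoffelFirstDeriv G k i j k x -
      christoffelFirstDeriv G j i k k x))
      =O[Bornology.cobounded (Eucl n)] fun x => ‖x‖ ^ (-τ - 2) :=
    Asymptotics.IsBigO.fun_sum fun k _ =>
      (h.christoffelFirstDeriv_isBigO k i j k).sub (h.christoffelFirstDeriv_isBigO j i k k)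
  simpa using ((h.ricci_sub_isBigO hτ i j).trans
    (rpow_isBigO_rpow (by linarith : -2 * τ - 2 ≤ -τ - 2))).add h1

theorem contDiffAt_massForm (h : IsFlatAtInfinity G τ R) :
    ∀ᶠ x in Bornology.cobounded (Eucl n), ∀ k, ContDiffAt ℝ ∞ (fun y => massForm G y k) x := by
  filter_upwards [h.contDiffAt_entry] with x hG k
  exact .sum fun i _ => (contDiffAt_pd (hG i k) i).sub (contDiffAt_pd (hG i i) k)

/-- The scalar curvature is, up to quadratic terms, the divergence of the mass form. -/
theorem scal_sub_isBigO (h : IsFlatAtInfinity G τ R) (hτ : 0 < τ) :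
    (fun x => scal G x - ∑ k, pd k (fun y => massForm G y k) x)
      =O[Bornology.cobounded (Eucl n)] fun x => ‖x‖ ^ (-2 * τ - 2) := by
  have h1 : (fun x => ∑ i, ((∑ j, (G x)⁻¹ i j * ricci G x i j - ricci G x i i) +
      (ricci G x i i - ∑ k, (christoffelFirstDeriv G k i i k x -
      christoffelFirstDeriv G i i k k x))))
      =O[Bornology.cobounded (Eucl n)] fun x => ‖x‖ ^ (-2 * τ - 2) :=
    Asymptotics.IsBigO.fun_sum fun i _ =>
      ((isBigO_contraction (A := fun j x => (G x)⁻¹ i j) (b := fun j x => ricci G x i j) i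
        (h.inv_entry_isBigO hτ i) (h.ricci_isBigO hτ i)).trans
        (rpow_mul_rpow_isBigO _ _ _ (by ring))).add (h.ricci_sub_isBigO hτ i i)
  refine h1.congr' ?_ .rfl
  filter_upwards [h.contDiffAt_entry] with x hG
  have d1 : ∀ l i j, DifferentiableAt ℝ (pd l fun y => G y i j) x := fun l i j =>
    (contDiffAt_pd (hG i j) l).differentiableAt (by simp)
  have e1 : ∀ k, pd k (fun y => massForm G y k) x =
      ∑ i, (pd k (pd i fun y => G y i k) x - pd k (pd k fun y => G y i i) x) := by
    intro k
    simp only [massForm]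
    rw [pd_fun_sum fun i _ => (d1 i i k).fun_sub (d1 k i i)]
    exact Finset.sum_congr rfl fun i _ => pd_fun_sub (d1 i i k) (d1 k i i) k
  have e2 : ∑ i, ∑ k, (christoffelFirstDeriv G k i i k x - christoffelFirstDeriv G i i k k x) =
      ∑ k, pd k (fun y => massForm G y k) x := by
    -- The mixed derivatives in the second term cancel, and the two half Laplacians of the trace
    -- agree after relabelling.
    have : ∀ i k, christoffelFirstDeriv G k i i k x - christoffelFirstDeriv G i i k k x =
        pd k (pd i fun y => G y i k) x - (1 / 2) * pd k (pd k fun y => G y i i) x -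
        (1 / 2) * pd i (pd i fun y => G y k k) x := by
      intro i k
      simp only [christoffelFirstDeriv]
      ring
    simp only [this, e1, Finset.sum_sub_distrib]
    rw [Finset.sum_comm (f := fun i k => pd k (pd i fun y => G y i k) x),
      Finset.sum_comm (f := fun i k => (1 / 2) * pd k (pd k fun y => G y i i) x)]
    simp only [← Finset.mul_sum]
    ring
  rw [← e2, scal]
  simp only [Finset.sum_add_distrib, Finset.sum_sub_distrib]
  ring

end IsFlatAtInfinity

end Connection

/-! ### Existence of the mass -/

theorem ChartAtInfinity.isFlatAtInfinity_metric {n : ℕ} {M : Type*} [TopologicalSpace M]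
    [ChartedSpace (Eucl n) M] [IsManifold (𝓡 n) ∞ M]
    [RiemannianBundle (fun p : M => TangentSpace (𝓡 n) p)]
    [IsContMDiffRiemannianBundle (𝓡 n) ∞ (Eucl n) (fun p : M => TangentSpace (𝓡 n) p)]
    (c : ChartAtInfinity n M) {τ : ℝ} (hflat : c.IsAsymptoticallyFlat τ) :
    IsFlatAtInfinity c.metric τ c.R where
  posSemidef x := by
    -- A Gram matrix for every `x`, also outside the target of the chart.
    have h := Matrix.posSemidef_gram ℝ fun i =>
      (mfderiv (𝓡 n) (𝓡 n) c.Φ.symm x (stdVec i) : TangentSpace (𝓡 n) (c.Φ.symm x))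
    exact h
  contDiffOn := c.contDiffOn_metric
  decay_zero := hflat.decay_zero
  decay_one := hflat.decay_one
  decay_two := hflat.decay_two

namespace IsFlatAtInfinity

variable {n : ℕ} {G : Eucl n → Matrix (Fin n) (Fin n) ℝ} {τ R : ℝ}

theorem eventually_half_le_sqrt_det (h : IsFlatAtInfinity G τ R) (hτ : 0 < τ) :
    ∀ᶠ x in Bornology.cobounded (Eucl n), 1 / 2 ≤ √(G x).det := by
  have h1 : Continuous fun A : Matrix (Fin n) (Fin n) ℝ => √A.det :=
    (continuous_id.matrix_det).sqrt
  have h2 := (h1.tendsto 1).comp (h.tendsto_one hτ)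
  rw [Matrix.det_one, Real.sqrt_one] at h2
  exact h2.eventually (le_mem_nhds (by norm_num))

theorem continuousAt_connCoeff (h : IsFlatAtInfinity G τ R) (hτ : 0 < τ) :
    ∀ᶠ x in Bornology.cobounded (Eucl n), ∀ i j k,
      ContinuousAt (fun y => connCoeff G y i j k) x := by
  filter_upwards [h.contDiffAt_entry, h.contDiffAt_inv_entry hτ,
    h.contDiffAt_frameMap_entry hτ] with x hG hGi hH i j k
  have c1 : ∀ i j, ContinuousAt (fun y => G y i j) x := fun i j => (hG i j).continuousAt
  have c2 : ∀ i j, ContinuousAt (fun y => (G y)⁻¹ i j) x := fun i j => (hGi i j).continuousAt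
  have c3 : ∀ i j, ContinuousAt (fun y => frameMap G y i j) x := fun i j => (hH i j).continuousAt
  have c4 : ∀ l i j, ContinuousAt (pd l fun y => G y i j) x := fun l i j =>
    (contDiffAt_pd (hG i j) l).continuousAt
  have c5 : ∀ l i j, ContinuousAt (pd l fun y => frameMap G y i j) x := fun l i j =>
    (((hH i j).fderiv_right (m := 0) (by simp)).clm_apply contDiffAt_const).continuousAt
  have c6 : ∀ i j l, ContinuousAt (fun y => christoffel G y l i j) x := fun i j l =>
    continuousAt_const.mul (tendsto_finsetSum _ fun m _ =>
      (c2 l m).mul (((c4 i j m).add (c4 j i m)).sub (c4 m i j)))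
  have c7 : ∀ l, ContinuousAt (fun y => nablaFrame G y i j l) x := fun l =>
    (c5 i l j).add (tendsto_finsetSum _ fun m _ => (c6 i m l).mul (c3 m j))
  exact tendsto_finsetSum _ fun l _ => tendsto_finsetSum _ fun p _ =>
    ((c1 l p).mul (c7 l)).mul (c3 p k)

theorem integrableOn_rpow {s : ℝ} (hs : s + n < 0) :
    IntegrableOn (fun x : Eucl n => ‖x‖ ^ s) (closedBall (0 : Eucl n) 1)ᶜ := by
  have h1 : Integrable fun x : Eucl n => (1 + ‖x‖) ^ (-(-s)) :=
    integrable_one_add_norm (by simp; linarith)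
  -- Outside the unit ball `(1 + ‖x‖)/2 ≤ ‖x‖`; raising this to the power `s ≤ 0` reverses it and
  -- produces the factor `2 ^ (-s)`.
  refine ((h1.const_mul (2 ^ (-s))).integrableOn (s := (closedBall (0 : Eucl n) 1)ᶜ)).mono'
    (measurable_norm.pow_const s).aestronglyMeasurable ?_
  refine (ae_restrict_iff' (isOpen_exterior 1).measurableSet).2 (.of_forall fun x hx => ?_)
  have hx1 : 1 < ‖x‖ := by simpa using hx
  have hx0 : 0 < ‖x‖ := by linarith
  have hs0 : s ≤ 0 := by
    have : (0 : ℝ) ≤ n := n.cast_nonneg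
    linarith
  rw [Real.norm_of_nonneg (by positivity), neg_neg, Real.rpow_neg zero_le_two,
    ← Real.inv_rpow zero_le_two, ← Real.mul_rpow (by norm_num) (by positivity)]
  exact Real.rpow_le_rpow_of_nonpos (by positivity) (by linarith) hs0

theorem tendsto_massIntegral (h : IsFlatAtInfinity G τ R) (hn : 3 ≤ n)
    (hτ : ((n : ℝ) - 2) / 2 < τ)
    (hscal : IntegrableOn (fun x => scal G x * √(G x).det) (closedBall 0 R)ᶜ) :
    Tendsto (massIntegral G) atTop (𝓝 (mass G)) := by
  have hn' : (3 : ℝ) ≤ n := by exact_mod_cast hn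
  have hτ0 : 0 < τ := by linarith
  obtain ⟨C, hC⟩ := (h.scal_sub_isBigO hτ0).bound
  obtain ⟨R₀, hR₀, hP⟩ := eventually_cobounded_iff.1
    (hC.and (h.contDiffAt_massForm.and (h.eventually_half_le_sqrt_det hτ0)))
  set R' := max R₀ (max R 1) with hR'
  have hsub : ∀ r ≤ R', (closedBall (0 : Eucl n) R')ᶜ ⊆ (closedBall 0 r)ᶜ := fun r hr =>
    Set.compl_subset_compl.2 (closedBall_subset_closedBall hr)
  have hP' : ∀ x ∈ (closedBall (0 : Eucl n) R')ᶜ, _ := fun x hx =>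
    hP x (hsub R₀ (le_max_left _ _) hx)
  have hF : ∀ k, ContDiffOn ℝ ∞ (fun x => massForm G x k) (closedBall (0 : Eucl n) R')ᶜ :=
    fun k x hx => ((hP' x hx).2.1 k).contDiffWithinAt
  refine tendsto_flux (by omega) (hR₀.trans (le_max_left _ _) : 0 ≤ R')
    (fun k => (hF k).of_le (by simp)) ?_
  have hcont : ContinuousOn (fun x => ∑ k, pd k (fun y => massForm G y k) x)
      (closedBall (0 : Eucl n) R')ᶜ := fun x hx =>
    (tendsto_finsetSum _ fun k _ =>
      (contDiffAt_pd ((hP' x hx).2.1 k) k).continuousAt.continuousWithinAt)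
  -- The factor 2 compensates for the volume density, which is at least `1/2` near infinity.
  have hI1 := (hscal.mono_set (hsub R ((le_max_left _ _).trans (le_max_right _ _)))).norm.const_mul 2
  have hI2 : IntegrableOn (fun x : Eucl n => C * ‖‖x‖ ^ (-2 * τ - 2)‖)
      (closedBall (0 : Eucl n) R')ᶜ :=
    ((integrableOn_rpow (by linarith)).mono_set
      (hsub 1 ((le_max_right _ _).trans (le_max_right _ _)))).norm.const_mul C
  refine (hI1.add hI2).mono' (hcont.aestronglyMeasurable (isOpen_exterior R').measurableSet) ?_
  refine (ae_restrict_iff' (isOpen_exterior R').measurableSet).2 (.of_forall fun x hx => ?_)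
  obtain ⟨h1, -, h3⟩ := hP' x hx
  simp only [Pi.add_apply, norm_mul, Real.norm_of_nonneg (Real.sqrt_nonneg _)]
  have h4 : ‖scal G x‖ ≤ 2 * (‖scal G x‖ * √(G x).det) := by
    nlinarith [norm_nonneg (scal G x)]
  have h5 := norm_sub_norm_le (∑ k, pd k (fun y => massForm G y k) x) (scal G x)
  rw [norm_sub_rev] at h5
  linarith

end IsFlatAtInfinity

/-! ### The limit of the boundary terms -/

section Boundary

variable {n : ℕ} {𝕜 : Type*} [RCLike 𝕜] {V : Type*} [NormedAddCommGroup V] [InnerProductSpace 𝕜 V]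
  [FiniteDimensional 𝕜 V] [Module ℝ V] [IsScalarTower ℝ 𝕜 V]
  {ρ : SO n →ₗ⁅ℝ⁆ Module.End 𝕜 V} {ι : Type*} [Fintype ι]
  {G : Eucl n → Matrix (Fin n) (Fin n) ℝ} {τ R : ℝ}

theorem continuous_boundary_integrand (W : ι → Submodule 𝕜 (RnTensor n V)) (α : ι → ℝ) {r : ℝ}
    (hG : ∀ ν : sphere (0 : Eucl n) 1, ∀ i j k,
      ContinuousAt (fun y => connCoeff G y i j k) (r • (ν : Eucl n))) (v : V) :
    Continuous fun ν : sphere (0 : Eucl n) 1 =>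
      inner 𝕜 (pureTensor 𝕜 (ν : Eucl n) v) (weightedProj W α (rhoConn ρ G v (r • (ν : Eucl n)))) := by
  have hc : ∀ i j k, Continuous fun ν : sphere (0 : Eucl n) 1 =>
      connCoeff G (r • (ν : Eucl n)) i j k := fun i j k =>
    continuous_iff_continuousAt.2 fun ν => ContinuousAt.comp (f := fun ν : sphere (0 : Eucl n) 1 =>
      r • (ν : Eucl n)) (hG ν i j k) (by fun_prop)
  have h1 : Continuous fun ν : sphere (0 : Eucl n) 1 => rhoConn ρ G v (r • (ν : Eucl n)) := by
    have : (fun ν : sphere (0 : Eucl n) 1 => rhoConn ρ G v (r • (ν : Eucl n))) =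
        fun ν : sphere (0 : Eucl n) 1 =>
        WithLp.toLp 2 fun i => rhoConn ρ G v (r • (ν : Eucl n)) i := rfl
    rw [this]
    refine (PiLp.continuous_toLp 2 _).comp (continuous_pi fun i => ?_)
    simp only [rhoConn_apply]
    refine continuous_finsetSum _ fun j _ => continuous_finsetSum _ fun k _ => ?_
    split_ifs
    · exact (RCLike.continuous_ofReal.comp (hc i j k)).smul continuous_const
    · exact continuous_const
  have h2 : Continuous fun ν : sphere (0 : Eucl n) 1 => pureTensor 𝕜 (ν : Eucl n) v := by
    refine (PiLp.continuous_toLp 2 _).comp (continuous_pi fun i => ?_)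
    exact (RCLike.continuous_ofReal.comp
      ((EuclideanSpace.proj i).continuous.comp continuous_subtype_val)).smul continuous_const
  simp only [← weightedProjLin_apply]
  exact h2.inner ((LinearMap.continuous_of_finiteDimensional (weightedProjLin W α)).comp h1)

theorem sphereIntegral_add {F : Type*} [NormedAddCommGroup F] [NormedSpace ℝ F]
    {f g : Eucl n → Eucl n → F} {r : ℝ}
    (hf : Continuous fun ν : sphere (0 : Eucl n) 1 => f (r • (ν : Eucl n)) ν)
    (hg : Continuous fun ν : sphere (0 : Eucl n) 1 => g (r • (ν : Eucl n)) ν) :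
    sphereIntegral (fun x ν => f x ν + g x ν) r = sphereIntegral f r + sphereIntegral g r := by
  simp only [sphereIntegral]
  rw [integral_add (integrable_sphere_of_continuous hf) (integrable_sphere_of_continuous hg),
    smul_add]

/-- The pointwise difference between the mass integrand and the boundary integrand. -/
noncomputable def boundaryError (ρ : SO n →ₗ⁅ℝ⁆ Module.End 𝕜 V) (W : ι → Submodule 𝕜 (RnTensor n V))
    (α : ι → ℝ) (G : Eucl n → Matrix (Fin n) (Fin n) ℝ) (x ν : Eucl n) : 𝕜 :=
  ∑ a, (ν a : 𝕜) * ∑ i, ∑ j, ∑ k, if j < k then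
    ((connCoeff G x i j k - (1 / 2) * (pd j (fun y => G y i k) x - pd k (fun y => G y i j) x) :
      ℝ) : 𝕜) * traceTensor ρ (weightedProjLin W α) a i j k else 0

/-- An exact pointwise identity: the linear part of the connection form contracts with the trace
tensor to `-c/2 = -μ(a)` times the mass form, and everything else is put into the error. -/
theorem sum_boundary_integrand_eq (hn : 3 ≤ n) (hρ : IsIrreducibleOrthogonal ρ)
    {W : ι → Submodule 𝕜 (RnTensor n V)} (hW : IsIrreducibleDecomposition ρ W) (α : ι → ℝ)
    (hG : ∀ x i j, G x i j = G x j i) {κ : Type*} [Fintype κ] (σ : OrthonormalBasis κ 𝕜 V)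
    (x ν : Eucl n) :
    ∑ l, inner 𝕜 (pureTensor 𝕜 ν (σ l)) (weightedProj W α (rhoConn ρ G (σ l) x)) =
      boundaryError ρ W α G x ν -
        ((massConstant ρ W α * ∑ k, massForm G x k * ν k : ℝ) : 𝕜) := by
  have h1 := fun a => sum_skew_mul_eq (t := traceTensor ρ (weightedProjLin W α))
    (traceTensor_skew ρ _) (traceTensor_symmetrization hn hρ hW α)
    (D := fun j i k => ((pd j (fun y => G y i k) x : ℝ) : 𝕜))
    (fun j i k => by simp only [hG _ i k]) a
  have h2 : ((massConstant ρ W α * ∑ k, massForm G x k * ν k : ℝ) : 𝕜) =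
      -∑ a, (ν a : 𝕜) * (-(((2 * massConstant ρ W α : ℝ) : 𝕜) / 2) *
        ∑ i, ((pd i (fun y => G y i a) x : ℝ) - (pd a (fun y => G y i i) x : ℝ) : 𝕜)) := by
    rw [Finset.mul_sum, ← Finset.sum_neg_distrib, RCLike.ofReal_sum]
    refine Finset.sum_congr rfl fun a _ => ?_
    simp only [massForm]
    push_cast
    ring
  rw [sum_inner_boundary, h2, sub_neg_eq_add, boundaryError, ← Finset.sum_add_distrib]
  refine Finset.sum_congr rfl fun a _ => ?_
  rw [← h1 a, ← mul_add]
  simp only [← Finset.sum_add_distrib]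
  congr 1
  refine Finset.sum_congr rfl fun i _ => Finset.sum_congr rfl fun j _ =>
    Finset.sum_congr rfl fun k _ => ?_
  split_ifs
  · push_cast
    ring
  · simp

theorem exists_norm_boundaryError_le (h : IsFlatAtInfinity G τ R) (hτ : 0 < τ)
    (W : ι → Submodule 𝕜 (RnTensor n V)) (α : ι → ℝ) :
    ∃ C R', 0 ≤ R' ∧ ∀ x ∈ (closedBall (0 : Eucl n) R')ᶜ, ∀ ν ∈ sphere (0 : Eucl n) 1,
      ‖boundaryError ρ W α G x ν‖ ≤ C * ‖x‖ ^ (-2 * τ - 1) := by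
  have h1 : ∀ a, (fun x => ∑ i, ∑ j, ∑ k, if j < k then
      ((connCoeff G x i j k - (1 / 2) * (pd j (fun y => G y i k) x - pd k (fun y => G y i j) x) :
      ℝ) : 𝕜) * traceTensor ρ (weightedProjLin W α) a i j k else 0)
      =O[Bornology.cobounded (Eucl n)] fun x => ‖x‖ ^ (-2 * τ - 1) := by
    intro a
    refine Asymptotics.IsBigO.fun_sum fun i _ => Asymptotics.IsBigO.fun_sum fun j _ =>
      Asymptotics.IsBigO.fun_sum fun k _ => ?_
    split_ifs
    · have h2 : (fun x => ((connCoeff G x i j k -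
          (1 / 2) * (pd j (fun y => G y i k) x - pd k (fun y => G y i j) x) : ℝ) : 𝕜))
          =O[Bornology.cobounded (Eucl n)] fun x => ‖x‖ ^ (-2 * τ - 1) :=
        .of_norm_left (by
          simpa only [RCLike.norm_ofReal, Real.norm_eq_abs] using
            (h.connCoeff_sub_isBigO hτ i j k).norm_left)
      exact (h2.const_mul_left _).congr_left fun x => mul_comm _ _
    · exact Asymptotics.isBigO_zero _ _
  have h2 := Asymptotics.IsBigO.fun_sum (s := Finset.univ) fun a _ => (h1 a).norm_left
  obtain ⟨C, hC⟩ := h2.bound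
  obtain ⟨R', hR', hP⟩ := eventually_cobounded_iff.1 hC
  refine ⟨C, R', hR', fun x hx ν hν => ?_⟩
  have h3 := hP x hx
  rw [Real.norm_of_nonneg (Finset.sum_nonneg fun _ _ => norm_nonneg _),
    Real.norm_of_nonneg (by positivity)] at h3
  refine le_trans ((norm_sum_le _ _).trans (Finset.sum_le_sum fun a _ => ?_)) h3
  rw [norm_mul, RCLike.norm_ofReal]
  refine mul_le_of_le_one_left (norm_nonneg _) ?_
  have := PiLp.norm_apply_le ν a
  rw [mem_sphere_zero_iff_norm.1 hν] at this
  simpa using this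

theorem tendsto_sum_boundaryIntegral (hn : 3 ≤ n) (h : IsFlatAtInfinity G τ R)
    (hτ : ((n : ℝ) - 2) / 2 < τ) (hmass : Tendsto (massIntegral G) atTop (𝓝 (mass G)))
    (hρ : IsIrreducibleOrthogonal ρ) {W : ι → Submodule 𝕜 (RnTensor n V)}
    (hW : IsIrreducibleDecomposition ρ W) (α : ι → ℝ) {κ : Type*} [Fintype κ]
    (σ : OrthonormalBasis κ 𝕜 V) :
    Tendsto (fun r => -∑ k, boundaryIntegral ρ W α G (σ k) r) atTop
      (𝓝 ((massConstant ρ W α * mass G : ℝ) : 𝕜)) := by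
  have hn' : (3 : ℝ) ≤ n := by exact_mod_cast hn
  have hτ0 : 0 < τ := by linarith
  obtain ⟨C, R₁, hR₁, hC⟩ := exists_norm_boundaryError_le (ρ := ρ) h hτ0 W α
  -- The exponent is `n - 2 - 2τ`, negative exactly by the assumption on `τ`.
  have hs : -2 * τ - 1 + ((n - 1 : ℕ) : ℝ) < 0 := by
    rw [Nat.cast_sub (by omega)]
    push_cast
    linarith
  have herr := tendsto_sphereIntegral_zero hs hR₁ hC
  obtain ⟨R₂, hR₂, hc⟩ := eventually_cobounded_iff.1
    ((h.continuousAt_connCoeff hτ0).and h.contDiffAt_massForm)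
  have hm : Tendsto (fun r => ((massConstant ρ W α * massIntegral G r : ℝ) : 𝕜)) atTop
      (𝓝 ((massConstant ρ W α * mass G : ℝ) : 𝕜)) :=
    (RCLike.continuous_ofReal.tendsto _).comp (hmass.const_mul _)
  have hlim := hm.sub herr
  rw [sub_zero] at hlim
  refine hlim.congr' ?_
  filter_upwards [eventually_gt_atTop R₂] with r hr
  have hcr := fun ν : sphere (0 : Eucl n) 1 => hc _ (smul_sphere_mem hR₂ hr ν)
  have hcont := fun v => continuous_boundary_integrand (ρ := ρ) W α (fun ν => (hcr ν).1) v
  have hmc : Continuous fun ν : sphere (0 : Eucl n) 1 =>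
      ((massConstant ρ W α * ∑ k, massForm G (r • (ν : Eucl n)) k * (ν : Eucl n) k : ℝ) : 𝕜) := by
    refine RCLike.continuous_ofReal.comp (continuous_const.mul
      (continuous_finsetSum _ fun k _ => Continuous.mul ?_ (by fun_prop)))
    exact continuous_iff_continuousAt.2 fun ν => ContinuousAt.comp
      (f := fun ν : sphere (0 : Eucl n) 1 => r • (ν : Eucl n)) (g := fun y => massForm G y k)
      ((hcr ν).2 k).continuousAt (by fun_prop)
  have e1 : ∑ k, boundaryIntegral ρ W α G (σ k) r = sphereIntegral (fun x ν =>
      ∑ l, inner 𝕜 (pureTensor 𝕜 ν (σ l)) (weightedProj W α (rhoConn ρ G (σ l) x))) r := by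
    simp only [boundaryIntegral, sphereIntegral]
    rw [integral_finsetSum _ fun k _ => integrable_sphere_of_continuous (hcont (σ k)),
      Finset.smul_sum]
  have e2 : sphereIntegral (boundaryError ρ W α G) r = sphereIntegral (fun x ν =>
      ∑ l, inner 𝕜 (pureTensor 𝕜 ν (σ l)) (weightedProj W α (rhoConn ρ G (σ l) x)) +
      ((massConstant ρ W α * ∑ k, massForm G x k * ν k : ℝ) : 𝕜)) r := by
    congr 1
    ext x ν
    rw [sum_boundary_integrand_eq hn hρ hW α h.symm σ x ν]
    ring
  have e3 : sphereIntegral (fun x ν =>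
      ((massConstant ρ W α * ∑ k, massForm G x k * ν k : ℝ) : 𝕜)) r =
      ((massConstant ρ W α * massIntegral G r : ℝ) : 𝕜) := by
    simp only [massIntegral, sphereIntegral]
    rw [integral_ofReal, integral_const_mul, RCLike.real_smul_eq_coe_mul, smul_eq_mul]
    push_cast
    ring
  rw [e1, e2, sphereIntegral_add (continuous_finsetSum _ fun k _ => hcont (σ k)) hmc, e3]
  ring

end Boundary

end UniversalMass

open UniversalMass
/-- No condition is imposed on the coefficients `a`; in particular they may be those of any
Weitzenböck formula. -/
theorem mainTheorem1
    {n : ℕ} (hn : 3 ≤ n)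
    -- a complete Riemannian manifold
    {M : Type*} [EMetricSpace M] [CompleteSpace M] [ChartedSpace (Eucl n) M]
    [IsManifold (𝓡 n) ∞ M]
    [RiemannianBundle (fun p : M => TangentSpace (𝓡 n) p)]
    [IsContMDiffRiemannianBundle (𝓡 n) ∞ (Eucl n) (fun p : M => TangentSpace (𝓡 n) p)]
    [IsRiemannianManifold (𝓡 n) M]
    -- which is asymptotically flat and has a mass
    (c : ChartAtInfinity n M) {τ : ℝ} (hτ : ((n : ℝ) - 2) / 2 < τ)
    (hflat : c.IsAsymptoticallyFlat τ) (hscal : c.ScalIntegrable)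
    -- an irreducible representation of `so(n)`, real or complex
    {𝕜 : Type*} [RCLike 𝕜] {V : Type*} [NormedAddCommGroup V] [InnerProductSpace 𝕜 V]
    [FiniteDimensional 𝕜 V] [Module ℝ V] [IsScalarTower ℝ 𝕜 V]
    (ρ : SO n →ₗ⁅ℝ⁆ Module.End 𝕜 V) (hρ : IsIrreducibleOrthogonal ρ)
    -- the splitting of `ℝⁿ ⊗ V`, real coefficients, and an orthonormal basis of `V`
    {ι : Type*} [Fintype ι] (W : ι → Submodule 𝕜 (RnTensor n V))
    (hW : IsIrreducibleDecomposition ρ W) (a : ι → ℝ)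
    {κ : Type*} [Fintype κ] (σ : OrthonormalBasis κ 𝕜 V) :
    -- the conformal weights and the mass are well defined
    (∀ j, ∀ t ∈ W j, confWeightOp ρ t = (confWeight ρ (W j) : 𝕜) • t) ∧
    Tendsto (massIntegral c.metric) atTop (𝓝 (mass c.metric)) ∧
    -- the sum of the boundary terms converges to `μ(a) m(g)`
    Tendsto (fun r => -∑ k, boundaryIntegral ρ W a c.metric (σ k) r) atTop
      (𝓝 ((massConstant ρ W a * mass c.metric : ℝ) : 𝕜)) ∧
    -- so that the sum of their limits is `μ(a) m(g)` as soon as these limits exist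
    (∀ L : κ → 𝕜,
      (∀ k, Tendsto (boundaryIntegral ρ W a c.metric (σ k)) atTop (𝓝 (L k))) →
      -∑ k, L k = ((massConstant ρ W a * mass c.metric : ℝ) : 𝕜)) := by
  have h := c.isFlatAtInfinity_metric hflat
  have hmass : Tendsto (massIntegral c.metric) atTop (𝓝 (mass c.metric)) :=
    h.tendsto_massIntegral hn hτ (c.target_eq ▸ hscal)
  have hlim := tendsto_sum_boundaryIntegral hn h hτ hmass hρ hW a σ
  exact ⟨fun j => confWeightOp_eq_confWeight_smul hρ (hW.irreducible j), hmass, hlim,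
    fun L hL => tendsto_nhds_unique (tendsto_finsetSum _ fun k _ => hL k).neg hlim⟩
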